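/- Let $\omega:[0,\infty)\to[0,\infty)$ be a non-quasianalytic subadditive weight function: $\omega$ is continuous and (weakly) increasing, $\omega(s+t)\le\omega(s)+\omega(t)$, $\int_1^\infty \omega(t)t^{-2}\,dt<\infty$, $\log t=o(\omega(t))$ as $t\to\infty$, and $t\mapsto\omega(e^t)$ is convex on $\mathbb R$. Write $\omega(x)=\omega(|x|)$ for vectors $x$ (Euclidean norm), $D^\alpha=(-i)^{|\alpha|}\partial^\alpha$ and $\hat u(\xi)=\int_{\mathbb R^d}e^{-i\langle x,\xi\rangle}u(x)\,dx$. Let $\mathcal S_\omega(\mathbb R^d)$ be the space of all $u\in\mathcal S(\mathbb R^d)$ with $$\sup_{x}e^{\lambda\omega(x)}|D^\alpha u(x)|<\infty,\qquad \sup_{\xi}e^{\lambda\omega(\xi)}|D^\alpha\hat u(\xi)|<\infty\qquad\text{for all }\lambda>0,\ \alpha\in\mathbb N_0^d,$$ with the topology given by these seminorms, and let $\mathcal S'_\omega(\mathbb R^d)$ be the space of continuous linear functionals $u:\mathcal S_\omega(\mathbb R^d)\to\mathbb C$, with $\langle u,\varphi\rangle:=u(\overline\varphi)$. For $u\in\mathcal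 S'_\omega$ let $(x^\alpha u)(f)=u(x^\alpha f)$ and $(D^\beta u)(f)=(-1)^{|\beta|}u(D^\beta f)$. For a window $\varphi\in\mathcal S_\omega(\mathbb R^d)\setminus\{0\}$ and $z=(x,\xi)\in\mathbb R^{2d}$ let $(\Pi(z)\varphi)(y)=e^{i\langle y,\xi\rangle}\varphi(y-x)$ and $V_\varphi u(z)=\langle u,\Pi(z)\varphi\rangle$. The wave front set $\mathrm{WF}'_{\omega}(u)\subseteq\mathbb R^{2d}\setminus\{0\}$, computed with the window $\varphi$, is defined as follows: $z_0\ne0$ is not in $\mathrm{WF}'_{\omega}(u)$ if and only if there is an open conic set $\Gamma\subseteq\mathbb R^{2d}\setminus\{0\}$ containing $z_0$ such that $\sup_{z\in\Gamma}e^{\lambda\omega(z)}|V_\varphi u(z)|<\infty$ for every $\lambda>0$. **Theorem.** Let $m\ge 0$ be an integer, and let $$A(x,D)=\sum_{|\alpha+\beta|\le m}c_{\alpha\beta}\,x^\alpha D^\beta,\qquad c_{\alpha\beta}\in\mathbb C,\ \alpha,\beta\in\mathbb N_0^d,$$ be a differential operator with polynomial coefficients. Then for every $u\in\mathcal S'_\omega(\mathbb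 R^d)$ $$\mathrm{WF}'_\omega(A(x,D)u)\subseteq\mathrm{WF}'_\omega(u),$$ where the two wave front sets may be computed with any two windows $\varphi,\psi\in\mathcal S_\omega(\mathbb R^d)\setminus\{0\}$, equal or different. -/

import Mathlib

noncomputable section

namespace OmegaGabor

open scoped SchwartzMap FourierTransform LineDeriv ENNReal ComplexConjugate

/-- The Euclidean space `ℝ^d`. -/
abbrev E (d : ℕ) : Type := EuclideanSpace ℝ (Fin d)

/-- Phase space `ℝ^{2d}`, the points `z = (x, ξ)`, with its Euclidean norm. -/
abbrev PhaseSpace (d : ℕ) : Type := WithLp 2 (E d × E d)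

/-- A non-quasianalytic subadditive weight function. Only its values on `[0, ∞)` matter;
as usual, `ω` is extended to vectors by `ω(x) = ω(|x|)`. -/
structure WeightFunction where
  toFun : ℝ → ℝ
  continuousOn : ContinuousOn toFun (Set.Ici 0)
  monotoneOn : MonotoneOn toFun (Set.Ici 0)
  nonneg : ∀ t, 0 ≤ t → 0 ≤ toFun t
  subadditive : ∀ s t, 0 ≤ s → 0 ≤ t → toFun (s + t) ≤ toFun s + toFun t
  nonquasianalytic :
    MeasureTheory.IntegrableOn (fun t => toFun t / t ^ 2) (Set.Ioi 1) MeasureTheory.volume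
  log_isLittleO : Real.log =o[Filter.atTop] toFun
  convex_exp : ConvexOn ℝ Set.univ (fun t => toFun (Real.exp t))

instance : CoeFun WeightFunction (fun _ => ℝ → ℝ) := ⟨WeightFunction.toFun⟩

variable {d : ℕ}

/-! ### Derivatives, monomials and the Fourier transform on the Schwartz space -/

/-- `D_j = -i ∂_j` on the Schwartz space. -/
def partialD (j : Fin d) : 𝓢(E d, ℂ) →L[ℂ] 𝓢(E d, ℂ) :=
  (-Complex.I) • LineDeriv.lineDerivOpCLM ℂ 𝓢(E d, ℂ) (EuclideanSpace.single j (1 : ℝ))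

theorem partialD_apply (j : Fin d) (f : 𝓢(E d, ℂ)) (x : E d) :
    partialD j f x = -Complex.I * fderiv ℝ f x (EuclideanSpace.single j (1 : ℝ)) := by
  simp [partialD, SchwartzMap.lineDerivOp_apply_eq_fderiv]

theorem partialD_commute (i j : Fin d) : Commute (partialD i) (partialD j) := by
  have key : ∀ (v w : E d) (f : 𝓢(E d, ℂ)), ∂_{v} (∂_{w} f) = ∂_{w} (∂_{v} f) := by
    intro v w f
    ext x
    have h1 : ∀ a b : E d, ∂_{a} (∂_{b} f) x = iteratedFDeriv ℝ 2 f x ![a, b] := by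
      intro a b
      rw [← SchwartzMap.iteratedLineDerivOp_eq_iteratedFDeriv]
      simp [LineDeriv.iteratedLineDerivOp_succ_left]
    rw [h1, h1, iteratedFDeriv_two_apply, iteratedFDeriv_two_apply]
    have hs : IsSymmSndFDerivAt ℝ f x :=
      (f.smooth 2).contDiffAt.isSymmSndFDerivAt (by simp)
    simpa using hs v w
  refine ContinuousLinearMap.ext fun f => ?_
  simp [partialD, key]

theorem pow_pairwise_commute (α : Fin d → ℕ) :
    ((Finset.univ : Finset (Fin d)) : Set (Fin d)).Pairwise
      (Function.onFun Commute fun j => partialD j ^ α j) :=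
  fun i _ j _ _ => (partialD_commute i j).pow_pow _ _

/-- `D^α = D_1^{α_1} ⋯ D_d^{α_d}` for a multi-index `α` (the factors commute). -/
def multiD (α : Fin d → ℕ) : 𝓢(E d, ℂ) →L[ℂ] 𝓢(E d, ℂ) :=
  Finset.univ.noncommProd (fun j => partialD j ^ α j) (pow_pairwise_commute α)

theorem multiD_zero : multiD (0 : Fin d → ℕ) = 1 := by
  unfold multiD
  rw [Finset.noncommProd_eq_pow_card _ _ _ 1 (by simp)]
  simp

theorem multiD_add (α β : Fin d → ℕ) : multiD (α + β) = multiD α * multiD β := by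
  unfold multiD
  rw [← Finset.noncommProd_mul_distrib]
  · refine Finset.noncommProd_congr rfl (fun j _ => ?_) _
    simp [pow_add]
  · exact fun i _ j _ _ => (partialD_commute i j).pow_pow _ _

theorem multiD_single (j : Fin d) : multiD (Pi.single j 1) = partialD j := by
  unfold multiD
  have h := Finset.mul_noncommProd_erase (Finset.univ : Finset (Fin d)) (Finset.mem_univ j)
    (fun i => partialD i ^ (Pi.single j 1 : Fin d → ℕ) i) (pow_pairwise_commute _)
  refine h.symm.trans ?_
  have h1 : ∀ i ∈ Finset.univ.erase j, partialD i ^ (Pi.single j 1 : Fin d → ℕ) i = 1 := by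
    intro i hi
    have : i ≠ j := Finset.ne_of_mem_erase hi
    simp [this]
  have h2 := Finset.noncommProd_eq_pow_card (Finset.univ.erase j)
    (fun i => partialD i ^ (Pi.single j 1 : Fin d → ℕ) i)
    (Set.Pairwise.mono (by simp) (pow_pairwise_commute _)) 1 h1
  refine (congrArg _ h2).trans ?_
  simp

theorem multiD_succ (α : Fin d → ℕ) (j : Fin d) (f : 𝓢(E d, ℂ)) :
    multiD (α + Pi.single j 1) f = multiD α (partialD j f) := by
  rw [multiD_add, multiD_single]; rfl

theorem multiD_succ' (α : Fin d → ℕ) (j : Fin d) (f : 𝓢(E d, ℂ)) :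
    multiD (α + Pi.single j 1) f = partialD j (multiD α f) := by
  rw [add_comm, multiD_add, multiD_single]; rfl

theorem multiIndex_induction {P : (Fin d → ℕ) → Prop} (h0 : P 0)
    (hs : ∀ α j, P α → P (α + Pi.single j 1)) (α : Fin d → ℕ) : P α := by
  induction hn : ∑ j, α j generalizing α with
  | zero =>
    have : α = 0 := by
      ext j
      simpa using (Finset.sum_eq_zero_iff.1 hn) j (Finset.mem_univ j)
    rwa [this]
  | succ n ih =>
    obtain ⟨j, hj⟩ : ∃ j, α j ≠ 0 := by
      by_contra! h
      simp [h] at hn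
    have hle : Pi.single j 1 ≤ α := by
      intro i
      by_cases hi : i = j
      · subst hi; simpa using Nat.one_le_iff_ne_zero.2 hj
      · simp [hi]
    rw [← tsub_add_cancel_of_le hle]
    apply hs
    apply ih
    have h2 : ∑ i, (α - Pi.single j 1 + Pi.single j 1 : Fin d → ℕ) i = n + 1 := by
      rw [tsub_add_cancel_of_le hle]; exact hn
    simp only [Pi.add_apply, Finset.sum_add_distrib, Finset.sum_pi_single', Finset.mem_univ,
      if_true] at h2
    omega

/-- The monomial `x^α`. -/
def monomial (α : Fin d → ℕ) (x : E d) : ℂ := ∏ j, (x j : ℂ) ^ α j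

theorem coord_hasTemperateGrowth (j : Fin d) :
    Function.HasTemperateGrowth (fun x : E d => (x j : ℂ)) :=
  (Complex.ofRealCLM.comp (EuclideanSpace.proj j : E d →L[ℝ] ℝ)).hasTemperateGrowth

theorem monomial_hasTemperateGrowth (α : Fin d → ℕ) :
    Function.HasTemperateGrowth (monomial α) := by
  refine multiIndex_induction (P := fun α => Function.HasTemperateGrowth (monomial α)) ?_ ?_ α
  · have : monomial (0 : Fin d → ℕ) = fun _ => 1 := by
      ext x
      simp [monomial]
    rw [this]
    exact Function.HasTemperateGrowth.const (1 : ℂ)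
  · intro α j h
    have : monomial (α + Pi.single j 1) = fun x : E d => (x j : ℂ) * monomial α x := by
      ext x
      simp only [monomial, Pi.add_apply, pow_add, Finset.prod_mul_distrib]
      rw [mul_comm]
      congr 1
      rw [Finset.prod_eq_single j] <;> simp +contextual
    rw [this]
    exact (coord_hasTemperateGrowth j).mul h

/-- Multiplication by `x^α` on the Schwartz space. -/
def mulMonomial (α : Fin d → ℕ) : 𝓢(E d, ℂ) →L[ℂ] 𝓢(E d, ℂ) :=
  SchwartzMap.smulLeftCLM ℂ (monomial α)

theorem mulMonomial_apply (α : Fin d → ℕ) (f : 𝓢(E d, ℂ)) (x : E d) :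
    mulMonomial α f x = monomial α x * f x := by
  simp [mulMonomial, monomial_hasTemperateGrowth α]

theorem mulMonomial_succ (α : Fin d → ℕ) (j : Fin d) (f : 𝓢(E d, ℂ)) :
    mulMonomial (α + Pi.single j 1) f = mulMonomial (Pi.single j 1) (mulMonomial α f) := by
  ext x
  simp only [mulMonomial_apply, ← mul_assoc]
  congr 1
  simp only [monomial, Pi.add_apply, pow_add, Finset.prod_mul_distrib]
  rw [mul_comm]

theorem monomial_single (j : Fin d) (x : E d) : monomial (Pi.single j 1) x = (x j : ℂ) := by
  rw [monomial, Finset.prod_eq_single j] <;> simp +contextual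

/-- The Fourier transform `û(ξ) = ∫ e^{-i⟨x,ξ⟩} u(x) dx` on the Schwartz space, obtained from
Mathlib's transform (which has `e^{-2πi⟨x,ξ⟩}`) by a dilation; see `fourier_apply`. -/
def fourier : 𝓢(E d, ℂ) →L[ℂ] 𝓢(E d, ℂ) :=
  (SchwartzMap.compCLMOfContinuousLinearEquiv ℂ
    (ContinuousLinearEquiv.smulLeft (Units.mk0 ((2 * Real.pi)⁻¹ : ℝ) (by positivity)) :
      E d ≃L[ℝ] E d)).comp (SchwartzMap.fourierTransformCLM ℂ)

theorem fourier_eq (u : 𝓢(E d, ℂ)) (ξ : E d) :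
    fourier u ξ = 𝓕 u ((2 * Real.pi)⁻¹ • ξ) := rfl

theorem fourier_apply (u : 𝓢(E d, ℂ)) (ξ : E d) :
    fourier u ξ = ∫ x, Complex.exp (-Complex.I * (inner ℝ x ξ : ℝ)) * u x := by
  rw [fourier_eq, SchwartzMap.fourier_coe, Real.fourier_eq']
  congr 1
  ext x
  rw [smul_eq_mul, inner_smul_right]
  congr 2
  have : (Real.pi : ℂ) ≠ 0 := by exact_mod_cast Real.pi_ne_zero
  push_cast
  field_simp

theorem fourier_partialD (j : Fin d) (u : 𝓢(E d, ℂ)) :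
    fourier (partialD j u) = mulMonomial (Pi.single j 1) (fourier u) := by
  ext ξ
  have hg : (fun x : E d => inner ℝ x (EuclideanSpace.single j (1 : ℝ))).HasTemperateGrowth := by
    fun_prop
  have : (Real.pi : ℂ) ≠ 0 := by exact_mod_cast Real.pi_ne_zero
  rw [mulMonomial_apply, fourier_eq, fourier_eq, monomial_single]
  have h : 𝓕 (partialD j u) = (-Complex.I) • 𝓕 (∂_{EuclideanSpace.single j (1 : ℝ)} u) := by
    rw [← FourierTransform.fourier_smul]; rfl
  rw [h, SchwartzMap.fourier_lineDerivOp_eq]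
  rw [smul_apply, smul_apply, SchwartzMap.smulLeftCLM_apply_apply hg]
  simp only [smul_eq_mul, Complex.real_smul, inner_smul_left, EuclideanSpace.inner_single_right]
  simp only [conj_trivial, one_mul]
  push_cast
  field_simp
  simp

theorem fourier_mulMonomial_single (j : Fin d) (u : 𝓢(E d, ℂ)) :
    fourier (mulMonomial (Pi.single j 1) u) = -partialD j (fourier u) := by
  have hg : (fun x : E d => inner ℝ x (EuclideanSpace.single j (1 : ℝ))).HasTemperateGrowth := by
    fun_prop
  have hpi : (Real.pi : ℂ) ≠ 0 := by exact_mod_cast Real.pi_ne_zero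
  have h1 : SchwartzMap.smulLeftCLM ℂ
      (fun x : E d => inner ℝ x (EuclideanSpace.single j (1 : ℝ))) u =
      mulMonomial (Pi.single j 1) u := by
    ext x
    rw [SchwartzMap.smulLeftCLM_apply_apply hg, mulMonomial_apply, monomial_single]
    simp [EuclideanSpace.inner_single_right]
  have h2 := SchwartzMap.lineDerivOp_fourier_eq u (EuclideanSpace.single j (1 : ℝ))
  rw [h1] at h2
  have h3 : ∂_{EuclideanSpace.single j (1 : ℝ)} (fourier u) =
      ((2 * Real.pi)⁻¹ : ℝ) • SchwartzMap.compCLMOfContinuousLinearEquiv ℂ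
        (ContinuousLinearEquiv.smulLeft (Units.mk0 ((2 * Real.pi)⁻¹ : ℝ) (by positivity)) :
          E d ≃L[ℝ] E d) (∂_{EuclideanSpace.single j (1 : ℝ)} (𝓕 u)) := by
    have := SchwartzMap.lineDerivOp_compCLMOfContinuousLinearEquiv (𝕜 := ℂ)
      (EuclideanSpace.single j (1 : ℝ)) (ContinuousLinearEquiv.smulLeft
        (Units.mk0 ((2 * Real.pi)⁻¹ : ℝ) (by positivity)) : E d ≃L[ℝ] E d) (𝓕 u)
    refine this.trans ?_
    have h5 := LineDeriv.lineDerivOp_left_smul ((2 * Real.pi)⁻¹ : ℝ)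
      (EuclideanSpace.single j (1 : ℝ) : E d) (𝓕 u)
    refine (congrArg _ h5).trans ?_
    rfl
  ext ξ
  have h4 : partialD j (fourier u) =
      (-Complex.I) • ∂_{EuclideanSpace.single j (1 : ℝ)} (fourier u) := rfl
  rw [h4, h3, h2, FourierTransform.fourier_smul]
  rw [fourier_eq]
  simp only [neg_apply, smul_apply, SchwartzMap.compCLMOfContinuousLinearEquiv_apply,
    Function.comp_apply, smul_eq_mul, Complex.real_smul]
  simp only [ContinuousLinearEquiv.smulLeft_apply_apply, Units.smul_mk0]
  push_cast
  field_simp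
  simp

/-! ### The space `S_ω` -/

/-- `sup_x e^{r ω(x)} |D^α v(x)|`, possibly infinite. -/
def weightedSup (ω : WeightFunction) (r : ℝ) (α : Fin d → ℕ) (v : 𝓢(E d, ℂ)) : ℝ≥0∞ :=
  ⨆ x : E d, ENNReal.ofReal (Real.exp (r * ω ‖x‖) * ‖multiD α v x‖)

theorem le_weightedSup (ω : WeightFunction) (r : ℝ) (α : Fin d → ℕ) (v : 𝓢(E d, ℂ)) (x : E d) :
    ENNReal.ofReal (Real.exp (r * ω ‖x‖) * ‖multiD α v x‖) ≤ weightedSup ω r α v :=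
  le_iSup (fun x : E d => ENNReal.ofReal (Real.exp (r * ω ‖x‖) * ‖multiD α v x‖)) x

theorem weightedSup_zero (ω : WeightFunction) (r : ℝ) (α : Fin d → ℕ) :
    weightedSup ω r α (0 : 𝓢(E d, ℂ)) = 0 := by
  simp [weightedSup]

theorem weightedSup_add_le (ω : WeightFunction) (r : ℝ) (α : Fin d → ℕ) (v w : 𝓢(E d, ℂ)) :
    weightedSup ω r α (v + w) ≤ weightedSup ω r α v + weightedSup ω r α w := by
  refine iSup_le fun x => ?_
  refine le_trans ?_ (add_le_add (le_weightedSup ω r α v x) (le_weightedSup ω r α w x))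
  rw [← ENNReal.ofReal_add (by positivity) (by positivity), ← mul_add]
  refine ENNReal.ofReal_le_ofReal ?_
  gcongr
  rw [map_add, add_apply]
  exact norm_add_le _ _

theorem weightedSup_smul (ω : WeightFunction) (r : ℝ) (α : Fin d → ℕ) (c : ℂ) (v : 𝓢(E d, ℂ)) :
    weightedSup ω r α (c • v) = ENNReal.ofReal ‖c‖ * weightedSup ω r α v := by
  unfold weightedSup
  rw [ENNReal.mul_iSup]
  refine iSup_congr fun x => ?_
  rw [← ENNReal.ofReal_mul (norm_nonneg _), map_smul, smul_apply, norm_smul]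
  congr 1
  ring

/-- `S_ω(ℝ^d)` as a subspace of the Schwartz space: all `u` such that
`sup e^{r ω(x)} |D^α u(x)| < ∞` and `sup e^{r ω(ξ)} |D^α û(ξ)| < ∞` for all `r > 0` and `α`. -/
def sOmega (ω : WeightFunction) (d : ℕ) : Submodule ℂ 𝓢(E d, ℂ) where
  carrier := {u | (∀ r : ℝ, 0 < r → ∀ α : Fin d → ℕ, weightedSup ω r α u < ⊤) ∧
    (∀ r : ℝ, 0 < r → ∀ α : Fin d → ℕ, weightedSup ω r α (fourier u) < ⊤)}
  add_mem' := by
    rintro u v ⟨hu, hu'⟩ ⟨hv, hv'⟩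
    refine ⟨fun r hr α => ?_, fun r hr α => ?_⟩
    · exact (weightedSup_add_le ω r α u v).trans_lt (ENNReal.add_lt_top.2 ⟨hu r hr α, hv r hr α⟩)
    · rw [map_add]
      exact (weightedSup_add_le ω r α _ _).trans_lt
        (ENNReal.add_lt_top.2 ⟨hu' r hr α, hv' r hr α⟩)
  zero_mem' := by
    refine ⟨fun r hr α => ?_, fun r hr α => ?_⟩
    · simp [weightedSup_zero]
    · simp [weightedSup_zero]
  smul_mem' := by
    rintro c u ⟨hu, hu'⟩
    refine ⟨fun r hr α => ?_, fun r hr α => ?_⟩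
    · rw [weightedSup_smul]
      exact ENNReal.mul_lt_top ENNReal.ofReal_lt_top (hu r hr α)
    · rw [map_smul, weightedSup_smul]
      exact ENNReal.mul_lt_top ENNReal.ofReal_lt_top (hu' r hr α)

/-- The space `S_ω(ℝ^d)`; a type of its own, so that it does not carry the topology induced by
the Schwartz space. -/
def SOmega (ω : WeightFunction) (d : ℕ) : Type := sOmega ω d

namespace SOmega

variable {ω : WeightFunction}

instance : AddCommGroup (SOmega ω d) := inferInstanceAs (AddCommGroup (sOmega ω d))

instance : Module ℂ (SOmega ω d) := inferInstanceAs (Module ℂ (sOmega ω d))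

/-- The inclusion of `S_ω` into the Schwartz space. -/
def toSchwartz : SOmega ω d →ₗ[ℂ] 𝓢(E d, ℂ) := (sOmega ω d).subtype

theorem toSchwartz_injective : Function.Injective (toSchwartz : SOmega ω d → 𝓢(E d, ℂ)) :=
  Subtype.val_injective

theorem toSchwartz_mem (u : SOmega ω d) : toSchwartz u ∈ sOmega ω d := u.2

/-- An element of `S_ω` given by a Schwartz function in the subspace. -/
def mk (u : 𝓢(E d, ℂ)) (hu : u ∈ sOmega ω d) : SOmega ω d := ⟨u, hu⟩

@[simp] theorem toSchwartz_mk (u : 𝓢(E d, ℂ)) (hu : u ∈ sOmega ω d) :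
    toSchwartz (mk u hu) = u := rfl

/-- The seminorm `u ↦ sup_x e^{r ω(x)} |D^α (L u)(x)|`, where all these suprema are finite. -/
def seminormAux (L : SOmega ω d →ₗ[ℂ] 𝓢(E d, ℂ)) (r : ℝ) (α : Fin d → ℕ)
    (hL : ∀ u, weightedSup ω r α (L u) < ⊤) : Seminorm ℂ (SOmega ω d) :=
  Seminorm.of (fun u => (weightedSup ω r α (L u)).toReal)
    (fun u v => by
      rw [← ENNReal.toReal_add (hL u).ne (hL v).ne, map_add]
      exact ENNReal.toReal_mono (ENNReal.add_lt_top.2 ⟨hL u, hL v⟩).ne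
        (weightedSup_add_le ω r α _ _))
    (fun c u => by
      rw [map_smul, weightedSup_smul, ENNReal.toReal_mul, ENNReal.toReal_ofReal (norm_nonneg c)])

/-- The seminorms of `S_ω`: `sup_x e^{r ω(x)} |D^α u(x)|` and `sup_ξ e^{r ω(ξ)} |D^α û(ξ)|`,
for `r > 0` and multi-indices `α`. -/
def seminorms (ω : WeightFunction) (d : ℕ) :
    SeminormFamily ℂ (SOmega ω d)
      ((Set.Ioi (0 : ℝ) × (Fin d → ℕ)) ⊕ (Set.Ioi (0 : ℝ) × (Fin d → ℕ))) :=
  Sum.elim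
    (fun i => seminormAux toSchwartz i.1 i.2 (fun u => u.toSchwartz_mem.1 _ i.1.2 _))
    (fun i => seminormAux (fourier.toLinearMap ∘ₗ toSchwartz) i.1 i.2
      (fun u => u.toSchwartz_mem.2 _ i.1.2 _))

theorem seminorms_inl (i : Set.Ioi (0 : ℝ) × (Fin d → ℕ)) (u : SOmega ω d) :
    seminorms ω d (Sum.inl i) u = (weightedSup ω i.1 i.2 u.toSchwartz).toReal := rfl

theorem seminorms_inr (i : Set.Ioi (0 : ℝ) × (Fin d → ℕ)) (u : SOmega ω d) :
    seminorms ω d (Sum.inr i) u = (weightedSup ω i.1 i.2 (fourier u.toSchwartz)).toReal := rfl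

/-- The locally convex topology of `S_ω`. -/
instance : TopologicalSpace (SOmega ω d) := (seminorms ω d).moduleFilterBasis.topology

theorem withSeminorms : WithSeminorms (seminorms ω d) := ⟨rfl⟩

instance : IsTopologicalAddGroup (SOmega ω d) := withSeminorms.topologicalAddGroup

instance : ContinuousSMul ℂ (SOmega ω d) := withSeminorms.continuousSMul

end SOmega

/-! ### Stability of `S_ω` under the operators that are used below -/

/-- `T` is bounded with respect to the weighted suprema. -/
def Tame (ω : WeightFunction) (T : 𝓢(E d, ℂ) →ₗ[ℂ] 𝓢(E d, ℂ)) : Prop :=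
  ∀ (r : ℝ) (α : Fin d → ℕ), 0 < r → ∃ (s : Finset (Set.Ioi (0 : ℝ) × (Fin d → ℕ))) (C : NNReal),
    ∀ v, weightedSup ω r α (T v) ≤ C * ∑ k ∈ s, weightedSup ω k.1 k.2 v

theorem Tame.decay {ω : WeightFunction} {T : 𝓢(E d, ℂ) →ₗ[ℂ] 𝓢(E d, ℂ)} (hT : Tame ω T)
    {v : 𝓢(E d, ℂ)} (hv : ∀ r : ℝ, 0 < r → ∀ α : Fin d → ℕ, weightedSup ω r α v < ⊤)
    (r : ℝ) (hr : 0 < r) (α : Fin d → ℕ) : weightedSup ω r α (T v) < ⊤ := by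
  obtain ⟨s, C, h⟩ := hT r α hr
  exact (h v).trans_lt (ENNReal.mul_lt_top ENNReal.coe_lt_top
    (ENNReal.sum_lt_top.2 fun k _ => hv _ k.1.2 _))

theorem Tame.smul {ω : WeightFunction} {T : 𝓢(E d, ℂ) →ₗ[ℂ] 𝓢(E d, ℂ)} (hT : Tame ω T) (c : ℂ) :
    Tame ω (c • T) := by
  intro r α hr
  obtain ⟨s, C, h⟩ := hT r α hr
  refine ⟨s, ‖c‖₊ * C, fun v => ?_⟩
  rw [LinearMap.smul_apply, weightedSup_smul, ENNReal.coe_mul, mul_assoc]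
  gcongr
  · rw [ofReal_norm]; rfl
  · exact h v

theorem weightedSup_multiD (ω : WeightFunction) (r : ℝ) (α β : Fin d → ℕ) (v : 𝓢(E d, ℂ)) :
    weightedSup ω r α (multiD β v) = weightedSup ω r (α + β) v := by
  simp only [weightedSup, multiD_add]; rfl

theorem tame_multiD (ω : WeightFunction) (β : Fin d → ℕ) :
    Tame ω (multiD β).toLinearMap := by
  intro r α hr
  refine ⟨{(⟨r, hr⟩, α + β)}, 1, fun v => ?_⟩
  simp [weightedSup_multiD]

theorem WeightFunction.exists_one_add_le (ω : WeightFunction) :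
    ∃ C : ℝ, 0 ≤ C ∧ ∀ t : ℝ, 0 ≤ t → 1 + t ≤ C * Real.exp (ω t) := by
  have h := (ω.log_isLittleO.bound (one_pos))
  obtain ⟨R, hR⟩ := Filter.eventually_atTop.1 h
  refine ⟨1 + max R 1 + 1, by positivity, fun t ht => ?_⟩
  have h1 : 1 ≤ Real.exp (ω t) := Real.one_le_exp (ω.nonneg t ht)
  have h1R : 1 ≤ max R 1 := le_max_right _ _
  rcases le_total t (max R 1) with h2 | h2
  · nlinarith
  · have h3 := hR t ((le_max_left _ _).trans h2)
    have h4 : 1 ≤ t := h1R.trans h2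
    rw [one_mul, Real.norm_eq_abs, Real.norm_eq_abs, abs_of_nonneg (ω.nonneg t ht)] at h3
    have h5 : t ≤ Real.exp (ω t) := by
      rw [← Real.log_le_iff_le_exp (by linarith)]
      exact (le_abs_self _).trans h3
    nlinarith

theorem hasTemperateGrowth_fderiv_apply {g : E d → ℂ} (hg : g.HasTemperateGrowth) (v : E d) :
    (fun x => -Complex.I * fderiv ℝ g x v).HasTemperateGrowth := by
  have h1 : (fderiv ℝ g).HasTemperateGrowth := by
    refine ⟨(contDiff_infty_iff_fderiv.1 hg.1).2, fun n => ?_⟩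
    obtain ⟨k, C, h⟩ := hg.2 (n + 1)
    exact ⟨k, C, fun x => by simpa [norm_iteratedFDeriv_fderiv] using h x⟩
  have h2 : (fun x => fderiv ℝ g x v).HasTemperateGrowth :=
    (ContinuousLinearMap.apply ℝ ℂ v).hasTemperateGrowth.comp h1
  exact (Function.HasTemperateGrowth.const (-Complex.I)).mul h2

theorem partialD_smulLeft {g : E d → ℂ} (hg : g.HasTemperateGrowth) (j : Fin d)
    (v : 𝓢(E d, ℂ)) :
    partialD j (SchwartzMap.smulLeftCLM ℂ g v) =
      SchwartzMap.smulLeftCLM ℂ g (partialD j v) +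
        SchwartzMap.smulLeftCLM ℂ
          (fun x => -Complex.I * fderiv ℝ g x (EuclideanSpace.single j (1 : ℝ))) v := by
  ext x
  rw [add_apply, SchwartzMap.smulLeftCLM_apply_apply hg,
    SchwartzMap.smulLeftCLM_apply_apply (hasTemperateGrowth_fderiv_apply hg _),
    partialD_apply, partialD_apply, SchwartzMap.smulLeftCLM_apply hg]
  have h1 : DifferentiableAt ℝ g x := (hg.1.differentiable (by simp)).differentiableAt
  have h2 : fderiv ℝ (fun x => g x • v x) x =
      g x • fderiv ℝ v x + (fderiv ℝ g x).smulRight (v x) :=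
    fderiv_fun_smul h1 v.differentiableAt
  rw [h2]
  simp
  ring

theorem tame_smulLeft (ω : WeightFunction) {g : E d → ℂ} (hg : g.HasTemperateGrowth) :
    Tame ω (SchwartzMap.smulLeftCLM ℂ g).toLinearMap := by
  intro r α
  revert g r
  refine multiIndex_induction (P := fun α => ∀ {g : E d → ℂ}, g.HasTemperateGrowth →
    ∀ r : ℝ, 0 < r → ∃ (s : Finset (Set.Ioi (0 : ℝ) × (Fin d → ℕ))) (C : NNReal),
      ∀ v, weightedSup ω r α (SchwartzMap.smulLeftCLM ℂ g v) ≤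
        C * ∑ k ∈ s, weightedSup ω k.1 k.2 v) ?_ ?_ α
  · intro g hg r hr
    obtain ⟨k, C, hC⟩ := hg.2 0
    obtain ⟨C', hC', h⟩ := ω.exists_one_add_le
    have hrk : 0 < r + k := by positivity
    refine ⟨{(⟨r + k, hrk⟩, 0)}, (|C| * C' ^ k).toNNReal, fun v => ?_⟩
    rw [Finset.sum_singleton]
    refine iSup_le fun x => ?_
    refine le_trans ?_ (mul_le_mul_right (le_weightedSup ω (r + k) 0 v x) _)
    change _ ≤ ENNReal.ofReal (|C| * C' ^ k) * _
    rw [← ENNReal.ofReal_mul (by positivity)]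
    refine ENNReal.ofReal_le_ofReal ?_
    rw [multiD_zero]
    change Real.exp (r * ω ‖x‖) * ‖SchwartzMap.smulLeftCLM ℂ g v x‖ ≤
      |C| * C' ^ k * (Real.exp ((r + k) * ω ‖x‖) * ‖v x‖)
    rw [SchwartzMap.smulLeftCLM_apply_apply hg, norm_smul]
    have h1 : ‖g x‖ ≤ |C| * (C' * Real.exp (ω ‖x‖)) ^ k := by
      have := hC x
      rw [norm_iteratedFDeriv_zero] at this
      refine this.trans (mul_le_mul (le_abs_self C) ?_ (by positivity) (abs_nonneg C))
      exact pow_le_pow_left₀ (by positivity) (h _ (norm_nonneg x)) k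
    calc Real.exp (r * ω ‖x‖) * (‖g x‖ * ‖v x‖)
        ≤ Real.exp (r * ω ‖x‖) * (|C| * (C' * Real.exp (ω ‖x‖)) ^ k * ‖v x‖) := by gcongr
      _ = _ := by
        rw [mul_pow, ← Real.exp_nat_mul, add_mul, Real.exp_add]
        ring
  · intro α j ih g hg r hr
    obtain ⟨s₁, C₁, h₁⟩ := ih hg r hr
    obtain ⟨s₂, C₂, h₂⟩ := ih (hasTemperateGrowth_fderiv_apply hg
      (EuclideanSpace.single j (1 : ℝ))) r hr
    classical
    let e : Set.Ioi (0 : ℝ) × (Fin d → ℕ) → Set.Ioi (0 : ℝ) × (Fin d → ℕ) :=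
      fun k => (k.1, k.2 + Pi.single j 1)
    refine ⟨s₁.image e ∪ s₂, C₁ + C₂, fun v => ?_⟩
    have h3 : weightedSup ω r (α + Pi.single j 1) (SchwartzMap.smulLeftCLM ℂ g v) =
        weightedSup ω r α (partialD j (SchwartzMap.smulLeftCLM ℂ g v)) := by
      rw [← multiD_single, weightedSup_multiD]
    have h4 : ∑ k ∈ s₁, weightedSup ω k.1 k.2 (partialD j v) =
        ∑ k ∈ s₁.image e, weightedSup ω k.1 k.2 v := by
      rw [Finset.sum_image]
      · refine Finset.sum_congr rfl fun k _ => ?_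
        rw [← multiD_single, weightedSup_multiD]
      · intro a _ b _ hab
        simpa [e, Prod.ext_iff] using hab
    rw [h3, partialD_smulLeft hg]
    refine (weightedSup_add_le ω r α _ _).trans ?_
    rw [ENNReal.coe_add, add_mul]
    refine add_le_add ((h₁ _).trans ?_) ((h₂ _).trans ?_)
    · rw [h4]
      gcongr
      exact Finset.subset_union_left
    · gcongr
      exact Finset.subset_union_right

theorem mem_sOmega_of_tame {ω : WeightFunction} {T T' : 𝓢(E d, ℂ) →ₗ[ℂ] 𝓢(E d, ℂ)}
    (hT : Tame ω T) (hT' : Tame ω T') (h : ∀ u, fourier (T u) = T' (fourier u))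
    {u : 𝓢(E d, ℂ)} (hu : u ∈ sOmega ω d) : T u ∈ sOmega ω d := by
  refine ⟨hT.decay hu.1, ?_⟩
  rw [h]
  exact hT'.decay hu.2

namespace SOmega

variable {ω : WeightFunction}

/-- The continuous operator on `S_ω` given by an operator on the Schwartz space. -/
def mapTame (T T' : 𝓢(E d, ℂ) →ₗ[ℂ] 𝓢(E d, ℂ)) (hT : Tame ω T) (hT' : Tame ω T')
    (h : ∀ u, fourier (T u) = T' (fourier u)) : SOmega ω d →L[ℂ] SOmega ω d where
  toFun u := mk (T u.toSchwartz) (mem_sOmega_of_tame hT hT' h u.toSchwartz_mem)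
  map_add' u v := toSchwartz_injective (by simp)
  map_smul' c u := toSchwartz_injective (by simp)
  cont := by
    have key : ∀ (S : 𝓢(E d, ℂ) →ₗ[ℂ] 𝓢(E d, ℂ)), Tame ω S → ∀ (L : SOmega ω d → 𝓢(E d, ℂ))
        (f : Set.Ioi (0 : ℝ) × (Fin d → ℕ) →
          (Set.Ioi (0 : ℝ) × (Fin d → ℕ)) ⊕ (Set.Ioi (0 : ℝ) × (Fin d → ℕ))),
        (∀ u (k : Set.Ioi (0 : ℝ) × (Fin d → ℕ)), weightedSup ω k.1 k.2 (L u) < ⊤) →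
        (∀ k u, seminorms ω d (f k) u = (weightedSup ω k.1 k.2 (L u)).toReal) →
        ∀ (r : ℝ) (α : Fin d → ℕ), 0 < r → ∃ (s : Finset _) (C : NNReal),
          ∀ u, (weightedSup ω r α (S (L u))).toReal ≤ (C • s.sup (seminorms ω d)) u := by
      intro S hS L f hL hf r α hr
      obtain ⟨s, C, hs⟩ := hS r α hr
      classical
      refine ⟨s.image f, C * s.card, fun u => ?_⟩
      have hfin : ∑ k ∈ s, weightedSup ω k.1 k.2 (L u) ≠ ⊤ :=
        (ENNReal.sum_lt_top.2 fun k _ => hL u k).ne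
      have h1 := ENNReal.toReal_mono (ENNReal.mul_ne_top ENNReal.coe_ne_top hfin) (hs (L u))
      refine h1.trans ?_
      rw [ENNReal.toReal_mul, ENNReal.toReal_sum (fun k _ => (hL u k).ne)]
      rw [smul_apply, NNReal.smul_def]
      have h2 : ∑ k ∈ s, (weightedSup ω k.1 k.2 (L u)).toReal ≤
          ∑ _k ∈ s, ((s.image f).sup (seminorms ω d)) u := by
        refine Finset.sum_le_sum fun k hk => ?_
        rw [← hf]
        exact Seminorm.le_def.1
          (Finset.le_sup (f := seminorms ω d) (Finset.mem_image_of_mem f hk)) u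
      rw [Finset.sum_const, nsmul_eq_mul] at h2
      simp only [ENNReal.coe_toReal, NNReal.coe_mul, NNReal.coe_natCast, smul_eq_mul]
      rw [mul_assoc]
      gcongr
    let F : SOmega ω d →ₗ[ℂ] SOmega ω d :=
      { toFun := fun u => mk (T u.toSchwartz) (mem_sOmega_of_tame hT hT' h u.toSchwartz_mem)
        map_add' := fun u v => toSchwartz_injective (by simp)
        map_smul' := fun c u => toSchwartz_injective (by simp) }
    change Continuous F
    refine WithSeminorms.continuous_of_isBounded withSeminorms withSeminorms F ?_
    rintro (⟨r, α⟩ | ⟨r, α⟩)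
    · obtain ⟨s, C, hs⟩ := key T hT toSchwartz Sum.inl (fun u k => u.toSchwartz_mem.1 _ k.1.2 _)
        (fun k u => rfl) r α r.2
      exact ⟨s, C, fun u => hs u⟩
    · obtain ⟨s, C, hs⟩ := key T' hT' (fun u => fourier u.toSchwartz) Sum.inr
        (fun u k => u.toSchwartz_mem.2 _ k.1.2 _) (fun k u => rfl) r α r.2
      refine ⟨s, C, fun u => ?_⟩
      have := hs u
      rw [← h] at this
      exact this

end SOmega

theorem fourier_multiD (β : Fin d → ℕ) (u : 𝓢(E d, ℂ)) :
    fourier (multiD β u) = mulMonomial β (fourier u) := by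
  refine multiIndex_induction
    (P := fun β => fourier (multiD β u) = mulMonomial β (fourier u)) ?_ ?_ β
  · ext ξ
    rw [multiD_zero, mulMonomial_apply]
    simp [monomial]
  · intro α j h
    rw [multiD_succ', fourier_partialD, h, mulMonomial_succ]

theorem fourier_mulMonomial (α : Fin d → ℕ) (u : 𝓢(E d, ℂ)) :
    fourier (mulMonomial α u) = (-1 : ℂ) ^ (∑ j, α j) • multiD α (fourier u) := by
  refine multiIndex_induction
    (P := fun α => fourier (mulMonomial α u) =
      (-1 : ℂ) ^ (∑ j, α j) • multiD α (fourier u)) ?_ ?_ α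
  · have : mulMonomial 0 u = u := by
      ext x
      rw [mulMonomial_apply]
      simp [monomial]
    rw [this, multiD_zero]
    simp
  · intro α j h
    rw [mulMonomial_succ, fourier_mulMonomial_single, h, map_smul, multiD_succ']
    simp [Finset.sum_add_distrib, pow_succ]

namespace SOmega

variable {ω : WeightFunction}

/-- `D^β` on `S_ω`. -/
def D (β : Fin d → ℕ) : SOmega ω d →L[ℂ] SOmega ω d :=
  mapTame (multiD β).toLinearMap (mulMonomial β).toLinearMap (tame_multiD ω β)
    (tame_smulLeft ω (monomial_hasTemperateGrowth β)) (fourier_multiD β)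

theorem toSchwartz_D (β : Fin d → ℕ) (u : SOmega ω d) :
    (D β u).toSchwartz = multiD β u.toSchwartz := rfl

/-- Multiplication by `x^α` on `S_ω`. -/
def mulX (α : Fin d → ℕ) : SOmega ω d →L[ℂ] SOmega ω d :=
  mapTame (mulMonomial α).toLinearMap ((-1 : ℂ) ^ (∑ j, α j) • (multiD α).toLinearMap)
    (tame_smulLeft ω (monomial_hasTemperateGrowth α)) ((tame_multiD ω α).smul _)
    (fourier_mulMonomial α)

theorem toSchwartz_mulX (α : Fin d → ℕ) (u : SOmega ω d) :
    (mulX α u).toSchwartz = mulMonomial α u.toSchwartz := rfl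

end SOmega

/-! ### Translation, modulation and complex conjugation -/

/-- The character `y ↦ e^{i⟨y,ξ⟩}`. -/
def character (ξ y : E d) : ℂ := Complex.exp (Complex.I * (inner ℝ y ξ : ℝ))

theorem character_hasTemperateGrowth (ξ : E d) : (character ξ).HasTemperateGrowth := by
  have h1 : (fun t : ℝ => Complex.exp (Complex.I * t)).HasTemperateGrowth := by
    have hd : ∀ n : ℕ, iteratedDeriv n (fun t : ℝ => Complex.exp (Complex.I * t)) =
        fun t : ℝ => Complex.I ^ n * Complex.exp (Complex.I * t) := by
      intro n
      induction n with
      | zero => simp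
      | succ n ih =>
        rw [iteratedDeriv_succ, ih]
        ext t
        have h : HasDerivAt (fun t : ℝ => Complex.I ^ n * Complex.exp (Complex.I * t))
            (Complex.I ^ n * (Complex.exp (Complex.I * t) * (Complex.I * 1))) t :=
          (((Complex.ofRealCLM.hasDerivAt (x := t)).const_mul Complex.I).cexp).const_mul _
        rw [h.deriv]
        ring
    refine ⟨(contDiff_const.mul Complex.ofRealCLM.contDiff).cexp, fun n => ⟨0, 1, fun t => ?_⟩⟩
    rw [norm_iteratedFDeriv_eq_norm_iteratedDeriv, hd]
    simp [mul_comm Complex.I, Complex.norm_exp_ofReal_mul_I]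
  have h2 : (fun y : E d => (inner ℝ y ξ : ℝ)).HasTemperateGrowth := by fun_prop
  exact h1.comp h2

/-- Translation `T_x f(y) = f(y - x)` on the Schwartz space. -/
def translation (x : E d) : 𝓢(E d, ℂ) →L[ℂ] 𝓢(E d, ℂ) := SchwartzMap.compSubConstCLM ℂ x

theorem translation_apply (x : E d) (f : 𝓢(E d, ℂ)) (y : E d) :
    translation x f y = f (y - x) := rfl

/-- Modulation `M_ξ f(y) = e^{i⟨y,ξ⟩} f(y)` on the Schwartz space. -/
def modulation (ξ : E d) : 𝓢(E d, ℂ) →L[ℂ] 𝓢(E d, ℂ) := SchwartzMap.smulLeftCLM ℂ (character ξ)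

theorem modulation_apply (ξ : E d) (f : 𝓢(E d, ℂ)) (y : E d) :
    modulation ξ f y = Complex.exp (Complex.I * (inner ℝ y ξ : ℝ)) * f y := by
  simp [modulation, character_hasTemperateGrowth ξ, character]

/-- Complex conjugation on the Schwartz space. -/
def conjugation (f : 𝓢(E d, ℂ)) : 𝓢(E d, ℂ) :=
  f.postcompCLM (Complex.conjCLE : ℂ →L[ℝ] ℂ)

theorem conjugation_apply (f : 𝓢(E d, ℂ)) (y : E d) : conjugation f y = conj (f y) := rfl

theorem multiD_intertwine (T : 𝓢(E d, ℂ) → 𝓢(E d, ℂ)) (c : ℂ)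
    (h : ∀ v j, partialD j (T v) = c • T (partialD j v)) (α : Fin d → ℕ) (v : 𝓢(E d, ℂ)) :
    multiD α (T v) = c ^ (∑ j, α j) • T (multiD α v) := by
  refine multiIndex_induction
    (P := fun α => multiD α (T v) = c ^ (∑ j, α j) • T (multiD α v)) ?_ ?_ α
  · simp [multiD_zero]
  · intro α j ih
    rw [multiD_succ', ih, map_smul, h, multiD_succ', smul_smul]
    simp [Finset.sum_add_distrib, pow_succ]

theorem WeightFunction.le_add (ω : WeightFunction) (x y : E d) :
    ω ‖y‖ ≤ ω ‖y - x‖ + ω ‖x‖ := by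
  have h : ‖y‖ ≤ ‖y - x‖ + ‖x‖ := by simpa using norm_add_le (y - x) x
  exact (ω.monotoneOn (norm_nonneg y) (Set.mem_Ici.2 (by positivity)) h).trans
    (ω.subadditive _ _ (norm_nonneg _) (norm_nonneg _))

theorem decay_translation {ω : WeightFunction} (x : E d) {v : 𝓢(E d, ℂ)}
    (hv : ∀ r : ℝ, 0 < r → ∀ α : Fin d → ℕ, weightedSup ω r α v < ⊤)
    (r : ℝ) (hr : 0 < r) (α : Fin d → ℕ) : weightedSup ω r α (translation x v) < ⊤ := by
  have h1 : ∀ (v : 𝓢(E d, ℂ)) j,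
      partialD j (translation x v) = (1 : ℂ) • translation x (partialD j v) := by
    intro v j
    ext y
    rw [one_smul, translation_apply, partialD_apply, partialD_apply]
    congr 2
    exact fderiv_comp_sub (f := v) x
  have h2 := multiD_intertwine (translation x) 1 h1 α v
  rw [one_pow, one_smul] at h2
  refine lt_of_le_of_lt (b := ENNReal.ofReal (Real.exp (r * ω ‖x‖)) * weightedSup ω r α v) ?_
    (ENNReal.mul_lt_top ENNReal.ofReal_lt_top (hv r hr α))
  refine iSup_le fun y => ?_
  refine le_trans ?_ (mul_le_mul_right (le_weightedSup ω r α v (y - x)) _)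
  rw [← ENNReal.ofReal_mul (by positivity), h2, translation_apply, ← mul_assoc, ← Real.exp_add]
  refine ENNReal.ofReal_le_ofReal ?_
  gcongr
  nlinarith [ω.le_add x y]

theorem decay_conjugation {ω : WeightFunction} {v : 𝓢(E d, ℂ)}
    (hv : ∀ r : ℝ, 0 < r → ∀ α : Fin d → ℕ, weightedSup ω r α v < ⊤)
    (r : ℝ) (hr : 0 < r) (α : Fin d → ℕ) : weightedSup ω r α (conjugation v) < ⊤ := by
  have h1 : ∀ (v : 𝓢(E d, ℂ)) j,
      partialD j (conjugation v) = (-1 : ℂ) • conjugation (partialD j v) := by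
    intro v j
    ext y
    rw [smul_apply, conjugation_apply, partialD_apply, partialD_apply]
    have : fderiv ℝ (conjugation v) y =
        (Complex.conjCLE : ℂ →L[ℝ] ℂ).comp (fderiv ℝ v y) :=
      ((Complex.conjCLE : ℂ →L[ℝ] ℂ).hasFDerivAt.comp y (v.hasFDerivAt y)).fderiv
    rw [this]
    simp
  have h2 := multiD_intertwine conjugation (-1) h1 α v
  refine lt_of_le_of_lt (le_of_eq ?_) (hv r hr α)
  refine iSup_congr fun y => ?_
  rw [h2, smul_apply, conjugation_apply, norm_smul]
  simp

theorem decay_reflection {ω : WeightFunction} {v : 𝓢(E d, ℂ)}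
    (hv : ∀ r : ℝ, 0 < r → ∀ α : Fin d → ℕ, weightedSup ω r α v < ⊤)
    (r : ℝ) (hr : 0 < r) (α : Fin d → ℕ) :
    weightedSup ω r α (SchwartzMap.compCLMOfContinuousLinearEquiv ℂ
      (ContinuousLinearEquiv.neg ℝ : E d ≃L[ℝ] E d) v) < ⊤ := by
  let R : 𝓢(E d, ℂ) → 𝓢(E d, ℂ) := fun v => SchwartzMap.compCLMOfContinuousLinearEquiv ℂ
      (ContinuousLinearEquiv.neg ℝ : E d ≃L[ℝ] E d) v
  have hR : ∀ v x, R v x = v (-x) := fun v x => rfl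
  have h1 : ∀ (v : 𝓢(E d, ℂ)) j, partialD j (R v) = (-1 : ℂ) • R (partialD j v) := by
    intro v j
    ext y
    rw [smul_apply, hR, partialD_apply, partialD_apply]
    have : fderiv ℝ (R v) y =
        (fderiv ℝ v (-y)).comp (-ContinuousLinearMap.id ℝ (E d)) :=
      ((v.hasFDerivAt (-y)).comp y (hasFDerivAt_id y).neg).fderiv
    rw [this]
    simp
  have h2 := multiD_intertwine R (-1) h1 α v
  refine lt_of_le_of_lt ?_ (hv r hr α)
  refine iSup_le fun y => ?_
  refine le_trans (le_of_eq ?_) (le_weightedSup ω r α v (-y))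
  change ENNReal.ofReal (Real.exp (r * ω ‖y‖) * ‖multiD α (R v) y‖) = _
  rw [h2, smul_apply, hR, norm_smul]
  simp

theorem fourier_translation (x : E d) (u : 𝓢(E d, ℂ)) :
    fourier (translation x u) = modulation (-x) (fourier u) := by
  ext ξ
  rw [modulation_apply, fourier_apply, fourier_apply, ← MeasureTheory.integral_const_mul]
  rw [← MeasureTheory.integral_add_right_eq_self _ x]
  congr 1
  ext y
  rw [translation_apply, add_sub_cancel_right, ← mul_assoc, ← Complex.exp_add]
  congr 2
  rw [inner_add_left, inner_neg_right, real_inner_comm x ξ]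
  push_cast
  ring

theorem fourier_modulation (ξ : E d) (u : 𝓢(E d, ℂ)) :
    fourier (modulation ξ u) = translation ξ (fourier u) := by
  ext η
  rw [translation_apply, fourier_apply, fourier_apply]
  congr 1
  ext y
  rw [modulation_apply, ← mul_assoc, ← Complex.exp_add, inner_sub_right]
  congr 2
  push_cast
  ring

theorem fourier_conjugation (u : 𝓢(E d, ℂ)) :
    fourier (conjugation u) = conjugation (SchwartzMap.compCLMOfContinuousLinearEquiv ℂ
      (ContinuousLinearEquiv.neg ℝ : E d ≃L[ℝ] E d) (fourier u)) := by
  ext ξ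
  rw [conjugation_apply, SchwartzMap.compCLMOfContinuousLinearEquiv_apply]
  change _ = conj (fourier u (-ξ))
  rw [fourier_apply, fourier_apply, ← integral_conj]
  congr 1
  ext y
  rw [conjugation_apply, map_mul, ← Complex.exp_conj, inner_neg_right]
  simp

namespace SOmega

variable {ω : WeightFunction}

/-- The translation `T_x` on `S_ω`. -/
def translate (x : E d) (f : SOmega ω d) : SOmega ω d :=
  mk (translation x f.toSchwartz) ⟨decay_translation x f.toSchwartz_mem.1, by
    rw [fourier_translation]
    exact (tame_smulLeft ω (character_hasTemperateGrowth (-x))).decay f.toSchwartz_mem.2⟩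

/-- The modulation `M_ξ` on `S_ω`. -/
def modulate (ξ : E d) (f : SOmega ω d) : SOmega ω d :=
  mk (modulation ξ f.toSchwartz)
    ⟨(tame_smulLeft ω (character_hasTemperateGrowth ξ)).decay f.toSchwartz_mem.1, by
      rw [fourier_modulation]
      exact decay_translation ξ f.toSchwartz_mem.2⟩

/-- Complex conjugation on `S_ω`. -/
def conjugate (f : SOmega ω d) : SOmega ω d :=
  mk (conjugation f.toSchwartz) ⟨decay_conjugation f.toSchwartz_mem.1, by
    rw [fourier_conjugation]
    exact decay_conjugation (decay_reflection f.toSchwartz_mem.2)⟩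

/-- The phase-space shift `Π(z) f(y) = M_ξ T_x f(y) = e^{i⟨y,ξ⟩} f(y - x)`, `z = (x, ξ)`. -/
def phaseShift (z : PhaseSpace d) (f : SOmega ω d) : SOmega ω d :=
  modulate z.snd (translate z.fst f)

theorem phaseShift_apply (z : PhaseSpace d) (f : SOmega ω d) (y : E d) :
    (phaseShift z f).toSchwartz y =
      Complex.exp (Complex.I * (inner ℝ y z.snd : ℝ)) * f.toSchwartz (y - z.fst) :=
  modulation_apply _ _ _

end SOmega

/-! ### `ω`-tempered distributions, the short-time Fourier transform, the wave front set -/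

/-- The space `S'_ω(ℝ^d)` of continuous linear functionals on `S_ω(ℝ^d)`. -/
abbrev SOmegaDual (ω : WeightFunction) (d : ℕ) : Type := SOmega ω d →L[ℂ] ℂ

namespace SOmegaDual

variable {ω : WeightFunction}

/-- The conjugate linear action `⟨u, φ⟩` of `S'_ω` on `S_ω` that is consistent with the inner
product `∫ u φ̄` of `L²`. -/
def pairing (u : SOmegaDual ω d) (φ : SOmega ω d) : ℂ := u φ.conjugate

/-- The short-time Fourier transform `V_φ u(z) = ⟨u, Π(z) φ⟩`. -/
def stft (φ : SOmega ω d) (u : SOmegaDual ω d) (z : PhaseSpace d) : ℂ :=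
  pairing u (SOmega.phaseShift z φ)

/-- The distribution `x^α u`, that is `(x^α u)(f) = u(x^α f)`. -/
def mulX (α : Fin d → ℕ) (u : SOmegaDual ω d) : SOmegaDual ω d := u.comp (SOmega.mulX α)

/-- The distribution `D^β u`, that is `(D^β u)(f) = (-1)^{|β|} u(D^β f)`. -/
def D (β : Fin d → ℕ) (u : SOmegaDual ω d) : SOmegaDual ω d :=
  (-1 : ℂ) ^ (∑ j, β j) • u.comp (SOmega.D β)

/-- The pairs of multi-indices `(α, β)` with `|α + β| ≤ m`. -/
def indexPairs (d m : ℕ) : Finset ((Fin d → ℕ) × (Fin d → ℕ)) :=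
  (Finset.Iic (fun _ => m) ×ˢ Finset.Iic (fun _ => m)).filter
    (fun p => ∑ j, (p.1 + p.2) j ≤ m)

theorem mem_indexPairs {m : ℕ} {p : (Fin d → ℕ) × (Fin d → ℕ)} :
    p ∈ indexPairs d m ↔ ∑ j, (p.1 + p.2) j ≤ m := by
  simp only [indexPairs, Finset.mem_filter, Finset.mem_product, Finset.mem_Iic,
    and_iff_right_iff_imp]
  intro h
  have : ∀ j, (p.1 + p.2) j ≤ m := fun j =>
    (Finset.single_le_sum (f := (p.1 + p.2)) (fun _ _ => Nat.zero_le _)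
      (Finset.mem_univ j)).trans h
  exact ⟨fun j => (Nat.le_add_right _ _).trans (this j),
    fun j => (Nat.le_add_left _ _).trans (this j)⟩

/-- `A(x,D) u = ∑_{|α+β| ≤ m} c_{αβ} x^α D^β u`. -/
def polynomialOperator (m : ℕ) (c : (Fin d → ℕ) → (Fin d → ℕ) → ℂ) (u : SOmegaDual ω d) :
    SOmegaDual ω d :=
  ∑ p ∈ indexPairs d m, c p.1 p.2 • mulX p.1 (D p.2 u)

/-- The `ω`-wave front set `WF'_ω(u)`, computed with the window `φ`: a point `z₀ ≠ 0` is not in it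
if and only if there is an open conic set `Γ ⊆ ℝ^{2d} \ {0}` containing `z₀` with
`sup_{z ∈ Γ} e^{r ω(z)} |V_φ u(z)| < ∞` for all `r > 0`. -/
def waveFrontSet (φ : SOmega ω d) (u : SOmegaDual ω d) : Set (PhaseSpace d) :=
  {z₀ | z₀ ≠ 0 ∧ ¬ ∃ Γ : Set (PhaseSpace d), IsOpen Γ ∧ (0 : PhaseSpace d) ∉ Γ ∧
    (∀ z ∈ Γ, ∀ t : ℝ, 0 < t → t • z ∈ Γ) ∧ z₀ ∈ Γ ∧
    ∀ r : ℝ, 0 < r → BddAbove ((fun z => Real.exp (r * ω ‖z‖) * ‖stft φ u z‖) '' Γ)}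

end SOmegaDual

end OmegaGabor

end

noncomputable section

namespace OmegaGabor

open scoped SchwartzMap FourierTransform LineDeriv ENNReal ComplexConjugate
open MeasureTheory

variable {d : ℕ} {ω : WeightFunction}

/-! ### Weights on configuration space and on phase space -/

namespace WeightFunction

/-! Write Π(p) for the shift M_ξ T_x with p = (x, ξ). Up to conjugating the window and reflecting ξ
(`stft_eq`), V_φ u is the function p ↦ u(Π(p)θ), so the wave front set records where this function
fails to decay. Two facts give the inclusion.

Commutation: if T is x_j or D_j, then T Π(p)θ = a(p) Π(p)θ + Π(p)Tθ, where a(p) is a coordinate of p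
and hence at most a constant times e^{ω(x)+ω(ξ)}. If u(Π(p)θ) decays faster than every e^{-rω} on a
set for all windows θ, the same therefore holds for u ∘ T on the same set
(`RapidOn.comp_of_commute`). Iteration reaches every operator with polynomial coefficients.

Change of window: decay for one nonzero window on an open cone gives decay for all windows on a
smaller cone around a given point (`RapidOn.of_window`, `exists_subcone`). This rests on the
inversion formula c u(f) = ∫ V_θ f(p) u(Π(p)θ) dp of `moyalConst_mul_apply`, applied to f = Π(q)φ.
The kernel |V_θ φ(p - q)| decays faster than every e^{-rω(p-q)}. For p in the cone, u(Π(p)θ) decays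
by assumption. For p outside, ω(q) ≤ κ ω(p - q), and the kernel beats the growth of u(Π(p)θ), which
is at most exponential in ω.

To prove the inversion formula, u must be taken under an integral sign. The seminorms of S_ω are
bounded by weighted L¹ norms of V_θ f, hence by weighted L² norms. By Hahn–Banach and Riesz, u(f) =
∫ V_θ f · h with h of controlled growth (`exists_integral_representation`). Inserting the
reproducing formula for V_θ f, a form of Moyal's identity, and applying Fubini's theorem completes
the argument. -/

theorem apply_norm_nonneg (ω : WeightFunction) (x : E d) : 0 ≤ ω ‖x‖ := ω.nonneg _ (norm_nonneg x)

theorem continuous_apply_norm (ω : WeightFunction) : Continuous fun x : E d => ω ‖x‖ :=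
  ω.continuousOn.comp_continuous continuous_norm fun x => norm_nonneg x

/-- The weight `ω(x) + ω(ξ)` on phase space, which is equivalent to `ω(z)`. -/
def split (ω : WeightFunction) (p : E d × E d) : ℝ := ω ‖p.1‖ + ω ‖p.2‖

theorem split_nonneg (ω : WeightFunction) (p : E d × E d) : 0 ≤ ω.split p :=
  add_nonneg (ω.apply_norm_nonneg _) (ω.apply_norm_nonneg _)

theorem continuous_split (ω : WeightFunction) : Continuous (ω.split : E d × E d → ℝ) :=
  (ω.continuous_apply_norm.comp continuous_fst).add (ω.continuous_apply_norm.comp continuous_snd)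

theorem split_le_add (ω : WeightFunction) (p q : E d × E d) :
    ω.split q ≤ ω.split (q - p) + ω.split p := by
  have h1 := ω.le_add p.1 q.1
  have h2 := ω.le_add p.2 q.2
  simp only [split, Prod.fst_sub, Prod.snd_sub]
  linarith

theorem split_sub_comm (ω : WeightFunction) (p q : E d × E d) :
    ω.split (p - q) = ω.split (q - p) := by
  simp only [split, Prod.fst_sub, Prod.snd_sub, norm_sub_rev]

/-- The condition log t = o(ω(t)) bounds 1 + |x| by C e^{ω(x)}, so e^{-sω} is dominated by a
multiple of (1 + |x|)^{-s} with s > d. The surplus `d + 1` in later exponents always pays for such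
an integral. -/
theorem integrable_exp_neg (ω : WeightFunction) {s : ℝ} (hs : d + 1 ≤ s) :
    Integrable fun x : E d => Real.exp (-(s * ω ‖x‖)) := by
  obtain ⟨C, hC, h⟩ := ω.exists_one_add_le
  have h1 : Integrable fun x : E d => C ^ s * (1 + ‖x‖) ^ (-s) := by
    refine (integrable_one_add_norm ?_).const_mul _
    simp
    linarith
  refine h1.mono' ?_ (Filter.Eventually.of_forall fun x => ?_)
  · exact (Real.continuous_exp.comp
      (ω.continuous_apply_norm.const_mul s).neg).aestronglyMeasurable
  · have hs0 : 0 ≤ s := by linarith [(Nat.cast_nonneg d : (0 : ℝ) ≤ d)]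
    have hx : 0 < 1 + ‖x‖ := by positivity
    have h2 := Real.rpow_le_rpow hx.le (h ‖x‖ (norm_nonneg x)) hs0
    rw [Real.mul_rpow hC (Real.exp_pos _).le, ← Real.exp_mul] at h2
    rw [Real.norm_of_nonneg (Real.exp_pos _).le, Real.rpow_neg hx.le, ← div_eq_mul_inv,
      le_div_iff₀ (Real.rpow_pos_of_pos hx s)]
    calc Real.exp (-(s * ω ‖x‖)) * (1 + ‖x‖) ^ s
        ≤ Real.exp (-(s * ω ‖x‖)) * (C ^ s * Real.exp (ω ‖x‖ * s)) := by gcongr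
      _ = C ^ s * (Real.exp (-(s * ω ‖x‖)) * Real.exp (ω ‖x‖ * s)) := by ring
      _ = C ^ s := by rw [← Real.exp_add, mul_comm s]; simp

theorem integrable_exp_neg_split (ω : WeightFunction) {s : ℝ} (hs : d + 1 ≤ s) :
    Integrable fun p : E d × E d => Real.exp (-(s * ω.split p)) := by
  refine ((ω.integrable_exp_neg hs).mul_prod (ω.integrable_exp_neg hs)).congr
    (Filter.Eventually.of_forall fun p => ?_)
  simp only [split, mul_add, neg_add, Real.exp_add]

theorem continuous_exp_split (ω : WeightFunction) (s : ℝ) :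
    Continuous fun p : E d × E d => Real.exp (s * ω.split p) :=
  Real.continuous_exp.comp (ω.continuous_split.const_mul s)

theorem exists_norm_le_exp (ω : WeightFunction) :
    ∃ C : ℝ, 0 ≤ C ∧ ∀ x : E d, ‖x‖ ≤ C * Real.exp (ω ‖x‖) := by
  obtain ⟨C, hC, h⟩ := ω.exists_one_add_le
  exact ⟨C, hC, fun x => by linarith [h ‖x‖ (norm_nonneg x)]⟩

end WeightFunction

theorem exists_norm_le_of_weightedSup {v : 𝓢(E d, ℂ)}
    (hv : ∀ r : ℝ, 0 < r → ∀ α : Fin d → ℕ, weightedSup ω r α v < ⊤) (r : ℝ) :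
    ∃ C : ℝ, 0 ≤ C ∧ ∀ x, ‖v x‖ ≤ C * Real.exp (-(r * ω ‖x‖)) := by
  -- The hypothesis covers positive rates only. A larger rate gives a stronger bound because ω ≥ 0,
  -- so every real `r` is reached.
  have h1 := hv (max r 1) (by positivity) 0
  refine ⟨(weightedSup ω (max r 1) 0 v).toReal, ENNReal.toReal_nonneg, fun x => ?_⟩
  have h2 := ENNReal.toReal_mono h1.ne (le_weightedSup ω (max r 1) 0 v x)
  rw [ENNReal.toReal_ofReal (by positivity), multiD_zero] at h2
  change Real.exp (max r 1 * ω ‖x‖) * ‖v x‖ ≤ _ at h2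
  rw [Real.exp_neg, ← div_eq_mul_inv, le_div_iff₀ (Real.exp_pos _), mul_comm]
  refine le_trans ?_ h2
  have := ω.apply_norm_nonneg x
  gcongr
  exact le_max_left _ _

theorem exists_norm_le {v : 𝓢(E d, ℂ)} (hv : v ∈ sOmega ω d) (r : ℝ) :
    ∃ C : ℝ, 0 ≤ C ∧ ∀ x, ‖v x‖ ≤ C * Real.exp (-(r * ω ‖x‖)) :=
  exists_norm_le_of_weightedSup hv.1 r

theorem exists_norm_fourier_le {v : 𝓢(E d, ℂ)} (hv : v ∈ sOmega ω d) (r : ℝ) :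
    ∃ C : ℝ, 0 ≤ C ∧ ∀ x, ‖fourier v x‖ ≤ C * Real.exp (-(r * ω ‖x‖)) :=
  exists_norm_le_of_weightedSup hv.2 r

/-! ### Parseval's identity and a consequence of Fourier inversion -/

theorem parseval (f g : 𝓢(E d, ℂ)) :
    ∫ ξ, fourier f ξ * conj (fourier g ξ) = ((2 * Real.pi) ^ d : ℝ) * ∫ x, f x * conj (g x) := by
  have h1 := SchwartzMap.integral_inner_fourier_fourier g f
  simp only [RCLike.inner_apply] at h1
  rw [← h1]
  have h2 := Measure.integral_comp_inv_smul (volume : Measure (E d))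
    (fun ξ => 𝓕 f ξ * conj (𝓕 g ξ)) (2 * Real.pi)
  simp only [fourier_eq]
  refine h2.trans ?_
  rw [Complex.real_smul, abs_of_nonneg (by positivity)]
  simp

/-- Fourier inversion, with its factor (2π)^{-d} ≤ 1 dropped. -/
theorem enorm_le_lintegral_fourier (h : 𝓢(E d, ℂ)) (y : E d) :
    ‖h y‖ₑ ≤ ∫⁻ ξ, ‖fourier h ξ‖ₑ := by
  have h1 : ‖h y‖ ≤ ∫ ξ, ‖𝓕 h ξ‖ := by
    have h2 : h y = 𝓕 (𝓕 h) (-y) := by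
      conv_lhs => rw [← FourierTransform.fourierInv_fourier_eq (E := 𝓢(E d, ℂ)) (F := 𝓢(E d, ℂ)) h]
      rw [SchwartzMap.fourierInv_coe, SchwartzMap.fourier_coe,
        Real.fourierInv_eq_fourier_neg]
      rfl
    rw [h2]
    exact (SchwartzMap.norm_fourier_apply_le_toLp_one _ _).trans_eq SchwartzMap.norm_toLp_one
  have h3 : ∫ ξ, ‖fourier h ξ‖ = (2 * Real.pi) ^ d * ∫ ξ, ‖𝓕 h ξ‖ := by
    have := Measure.integral_comp_inv_smul (volume : Measure (E d))
      (fun ξ => ‖𝓕 h ξ‖) (2 * Real.pi)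
    simp only [fourier_eq]
    refine this.trans ?_
    rw [smul_eq_mul, abs_of_nonneg (by positivity)]
    simp
  have h4 : (1 : ℝ) ≤ (2 * Real.pi) ^ d := one_le_pow₀ (by linarith [Real.pi_gt_three])
  have h5 : ‖h y‖ ≤ ∫ ξ, ‖fourier h ξ‖ := by
    rw [h3]
    have : 0 ≤ ∫ ξ, ‖𝓕 h ξ‖ := integral_nonneg fun _ => norm_nonneg _
    nlinarith
  rw [← ofReal_integral_norm_eq_lintegral_enorm (fourier h).integrable, ← ofReal_norm]
  exact ENNReal.ofReal_le_ofReal h5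

/-! ### The short-time Fourier transform of Schwartz functions -/

/-- The phase-space shift `M_ξ T_x` on the Schwartz space. -/
def shift (p : E d × E d) (θ : 𝓢(E d, ℂ)) : 𝓢(E d, ℂ) := modulation p.2 (translation p.1 θ)

theorem shift_apply (p : E d × E d) (θ : 𝓢(E d, ℂ)) (y : E d) :
    shift p θ y = Complex.exp (Complex.I * (inner ℝ y p.2 : ℝ)) * θ (y - p.1) :=
  modulation_apply _ _ _

theorem norm_shift_apply (p : E d × E d) (θ : 𝓢(E d, ℂ)) (y : E d) :
    ‖shift p θ y‖ = ‖θ (y - p.1)‖ := by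
  rw [shift_apply, norm_mul, mul_comm Complex.I, Complex.norm_exp_ofReal_mul_I, one_mul]

/-- The short-time Fourier transform `∫ f(y) conj (M_ξ T_x θ(y)) dy` of a Schwartz function. -/
def gabor (θ f : 𝓢(E d, ℂ)) (p : E d × E d) : ℂ := ∫ y, f y * conj (shift p θ y)

theorem exists_norm_le_const (f : 𝓢(E d, ℂ)) : ∃ C : ℝ, 0 ≤ C ∧ ∀ x, ‖f x‖ ≤ C :=
  ⟨SchwartzMap.seminorm ℝ 0 0 f, apply_nonneg _ _, fun x => SchwartzMap.norm_le_seminorm ℝ f x⟩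

theorem integrable_mul_conj (f g : 𝓢(E d, ℂ)) : Integrable fun y => f y * conj (g y) := by
  obtain ⟨C, hC, h⟩ := exists_norm_le_const g
  refine Integrable.mul_bdd (c := C) f.integrable
    (Complex.continuous_conj.comp g.continuous).aestronglyMeasurable
    (Filter.Eventually.of_forall fun y => ?_)
  simpa using h y

theorem continuous_gabor (θ f : 𝓢(E d, ℂ)) : Continuous (gabor θ f) := by
  obtain ⟨C, hC, h⟩ := exists_norm_le_const θ
  refine continuous_of_dominated (bound := fun y => ‖f y‖ * C) (fun p => ?_) (fun p => ?_)
    (f.integrable.norm.mul_const C) (Filter.Eventually.of_forall fun y => ?_)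
  · exact (integrable_mul_conj f (shift p θ)).aestronglyMeasurable
  · refine Filter.Eventually.of_forall fun y => ?_
    rw [norm_mul, RCLike.norm_conj, norm_shift_apply]
    gcongr
    exact h _
  · have := θ.continuous
    simp only [shift_apply]
    refine continuous_const.mul (Complex.continuous_conj.comp ?_)
    fun_prop

theorem gabor_add (θ f g : 𝓢(E d, ℂ)) (p : E d × E d) :
    gabor θ (f + g) p = gabor θ f p + gabor θ g p := by
  simp only [gabor, add_apply, add_mul]
  exact integral_add (integrable_mul_conj _ _) (integrable_mul_conj _ _)

theorem gabor_smul (θ f : 𝓢(E d, ℂ)) (c : ℂ) (p : E d × E d) :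
    gabor θ (c • f) p = c * gabor θ f p := by
  simp only [gabor, smul_apply, smul_eq_mul, mul_assoc]
  exact integral_const_mul _ _

/-- The localization `f · conj (T_x θ)` of `f`. -/
def localize (θ : 𝓢(E d, ℂ)) (x : E d) (f : 𝓢(E d, ℂ)) : 𝓢(E d, ℂ) :=
  SchwartzMap.smulLeftCLM ℂ (conjugation (translation x θ)) f

theorem localize_apply (θ : 𝓢(E d, ℂ)) (x : E d) (f : 𝓢(E d, ℂ)) (y : E d) :
    localize θ x f y = conj (θ (y - x)) * f y := by
  rw [localize, SchwartzMap.smulLeftCLM_apply_apply (SchwartzMap.hasTemperateGrowth _)]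
  rfl

/-- For fixed x, the slice ξ ↦ V_θ f(x, ξ) is the Fourier transform of a Schwartz function;
Parseval's identity and Fourier inversion thus apply slice by slice. -/
theorem fourier_localize (θ f : 𝓢(E d, ℂ)) (x ξ : E d) :
    fourier (localize θ x f) ξ = gabor θ f (x, ξ) := by
  rw [fourier_apply, gabor]
  congr 1
  ext y
  rw [localize_apply, shift_apply, map_mul, ← Complex.exp_conj]
  simp
  ring

theorem fourier_shift (p : E d × E d) (θ : 𝓢(E d, ℂ)) :
    fourier (shift p θ) =
      Complex.exp (Complex.I * (inner ℝ p.1 p.2 : ℝ)) • shift (p.2, -p.1) (fourier θ) := by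
  rw [shift, fourier_modulation, fourier_translation]
  ext η
  rw [smul_apply, shift_apply, translation_apply, modulation_apply, smul_eq_mul, ← mul_assoc,
    ← Complex.exp_add]
  congr 2
  simp only [inner_sub_left, inner_neg_right, real_inner_comm p.1 p.2]
  push_cast
  ring

/-- The short-time Fourier transform of the Fourier transform is a rotation. -/
theorem norm_gabor_fourier (θ f : 𝓢(E d, ℂ)) (p : E d × E d) :
    ‖gabor (fourier θ) (fourier f) (p.2, -p.1)‖ = (2 * Real.pi) ^ d * ‖gabor θ f p‖ := by
  have h := parseval f (shift p θ)
  simp only [fourier_shift, smul_apply, smul_eq_mul, map_mul] at h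
  have h2 : ∀ ξ, fourier f ξ * (conj (Complex.exp (Complex.I * (inner ℝ p.1 p.2 : ℝ))) *
      conj (shift (p.2, -p.1) (fourier θ) ξ)) =
      conj (Complex.exp (Complex.I * (inner ℝ p.1 p.2 : ℝ))) *
        (fourier f ξ * conj (shift (p.2, -p.1) (fourier θ) ξ)) := fun ξ => by ring
  simp only [h2] at h
  rw [integral_const_mul] at h
  have h3 := congrArg norm h
  rw [norm_mul, RCLike.norm_conj, mul_comm Complex.I, Complex.norm_exp_ofReal_mul_I, one_mul,
    norm_mul, Complex.norm_real, Real.norm_of_nonneg (by positivity)] at h3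
  exact h3

/-- Covariance of the short-time Fourier transform under phase-space shifts. -/
theorem gabor_shift (θ f : 𝓢(E d, ℂ)) (p q : E d × E d) :
    gabor θ (shift p f) q =
      Complex.exp (Complex.I * (inner ℝ p.1 (p.2 - q.2) : ℝ)) * gabor θ f (q - p) := by
  rw [gabor, gabor, ← integral_const_mul, ← integral_add_right_eq_self _ p.1]
  congr 1
  ext y
  simp only [shift_apply, map_mul, ← Complex.exp_conj, Complex.conj_I, Complex.conj_ofReal,
    Prod.fst_sub, Prod.snd_sub, add_sub_cancel_right]
  rw [show y + p.1 - q.1 = y - (q.1 - p.1) by abel]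
  have h1 : Complex.exp (Complex.I * (inner ℝ (y + p.1) p.2 : ℝ)) *
      Complex.exp (-Complex.I * (inner ℝ (y + p.1) q.2 : ℝ)) =
      Complex.exp (Complex.I * (inner ℝ p.1 (p.2 - q.2) : ℝ)) *
      Complex.exp (-Complex.I * (inner ℝ y (q.2 - p.2) : ℝ)) := by
    rw [← Complex.exp_add, ← Complex.exp_add]
    congr 1
    simp only [inner_sub_right, inner_add_left]
    push_cast
    ring
  linear_combination (f y * conj (θ (y - (q.1 - p.1)))) * h1

theorem norm_gabor_shift (θ f : 𝓢(E d, ℂ)) (p q : E d × E d) :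
    ‖gabor θ (shift p f) q‖ = ‖gabor θ f (q - p)‖ := by
  rw [gabor_shift, norm_mul, mul_comm Complex.I, Complex.norm_exp_ofReal_mul_I, one_mul]

theorem continuous_gabor_shift (θ f : 𝓢(E d, ℂ)) :
    Continuous fun z : (E d × E d) × (E d × E d) => gabor θ (shift z.1 f) z.2 := by
  have := continuous_gabor θ f
  simp only [gabor_shift]
  fun_prop

theorem conj_gabor_shift (θ φ : 𝓢(E d, ℂ)) (p q : E d × E d) :
    conj (gabor θ (shift q φ) p) = gabor φ (shift p θ) q := by
  rw [gabor, gabor, ← integral_conj]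
  congr 1
  ext y
  simp [mul_comm]

/-! ### Decay of the short-time Fourier transform on `S_ω` -/

/-- Since ω(x) ≤ ω(y) + ω(y - x), the decay of f at y and of θ at y - x combine to decay in x; the
extra `d + 1` in the rate of f makes the y-integral converge. -/
theorem norm_gabor_le {f θ : 𝓢(E d, ℂ)} {r C₁ C₂ : ℝ} (hr : 0 ≤ r) (hC₁ : 0 ≤ C₁)
    (hf : ∀ y, ‖f y‖ ≤ C₁ * Real.exp (-((r + (d + 1)) * ω ‖y‖)))
    (hθ : ∀ y, ‖θ y‖ ≤ C₂ * Real.exp (-(r * ω ‖y‖))) (p : E d × E d) :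
    ‖gabor θ f p‖ ≤
      C₁ * C₂ * (∫ y : E d, Real.exp (-((d + 1) * ω ‖y‖))) * Real.exp (-(r * ω ‖p.1‖)) := by
  have hC₂ : 0 ≤ C₂ := by
    have := (norm_nonneg _).trans (hθ 0)
    exact nonneg_of_mul_nonneg_left this (Real.exp_pos _)
  rw [gabor, mul_assoc, mul_comm (∫ y : E d, _), ← mul_assoc, ← integral_const_mul]
  refine norm_integral_le_of_norm_le ((ω.integrable_exp_neg le_rfl).const_mul _)
    (Filter.Eventually.of_forall fun y => ?_)
  rw [norm_mul, RCLike.norm_conj, norm_shift_apply]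
  refine (mul_le_mul (hf y) (hθ (y - p.1)) (norm_nonneg _) (by positivity)).trans ?_
  have h1 : Real.exp (-((r + (d + 1)) * ω ‖y‖)) * Real.exp (-(r * ω ‖y - p.1‖)) ≤
      Real.exp (-(r * ω ‖p.1‖)) * Real.exp (-((d + 1) * ω ‖y‖)) := by
    rw [← Real.exp_add, ← Real.exp_add, Real.exp_le_exp]
    have h2 := ω.le_add y p.1
    rw [norm_sub_rev] at h2
    nlinarith
  calc _ = C₁ * C₂ * (Real.exp (-((r + (d + 1)) * ω ‖y‖)) * Real.exp (-(r * ω ‖y - p.1‖))) := by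
        ring
    _ ≤ C₁ * C₂ * (Real.exp (-(r * ω ‖p.1‖)) * Real.exp (-((d + 1) * ω ‖y‖))) := by gcongr
    _ = _ := by ring

/-- Decay in x comes from the decay of f and θ. Decay in ξ is the same estimate for their Fourier
transforms, because V_θ f and the transform of f̂ with window θ̂ differ by a rotation of phase space
and a constant modulus. -/
theorem exists_norm_gabor_le {f θ : 𝓢(E d, ℂ)} (hf : f ∈ sOmega ω d) (hθ : θ ∈ sOmega ω d)
    (r : ℝ) : ∃ C : ℝ, 0 ≤ C ∧ ∀ p, ‖gabor θ f p‖ ≤ C * Real.exp (-(r * ω.split p)) := by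
  set s : ℝ := max (2 * r) 0 with hs
  have hs0 : 0 ≤ s := le_max_right _ _
  obtain ⟨A₁, hA₁, h₁⟩ := exists_norm_le hf (s + (d + 1))
  obtain ⟨A₂, hA₂, h₂⟩ := exists_norm_le hθ s
  obtain ⟨B₁, hB₁, h₃⟩ := exists_norm_fourier_le hf (s + (d + 1))
  obtain ⟨B₂, hB₂, h₄⟩ := exists_norm_fourier_le hθ s
  set J := ∫ y : E d, Real.exp (-((d + 1) * ω ‖y‖))
  have hJ : 0 ≤ J := integral_nonneg fun _ => (Real.exp_pos _).le
  refine ⟨A₁ * A₂ * J + B₁ * B₂ * J, by positivity, fun p => ?_⟩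
  have h5 := norm_gabor_le hs0 hA₁ h₁ h₂ p
  have h6 := norm_gabor_le hs0 hB₁ h₃ h₄ (p.2, -p.1)
  rw [norm_gabor_fourier] at h6
  have h7 : ‖gabor θ f p‖ ≤ (2 * Real.pi) ^ d * ‖gabor θ f p‖ :=
    le_mul_of_one_le_left (norm_nonneg _) (one_le_pow₀ (by linarith [Real.pi_gt_three]))
  have hs2 : 2 * r ≤ s := le_max_left _ _
  have w1 := ω.apply_norm_nonneg p.1
  have w2 := ω.apply_norm_nonneg p.2
  change _ ≤ B₁ * B₂ * J * Real.exp (-(s * ω ‖p.2‖)) at h6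
  -- The larger of ω(x) and ω(ξ) is at least half their sum, so rate s ≥ 2r in that variable alone
  -- gives rate r in the sum; s ≥ 0 takes care of negative r.
  have key : ∀ a b : ℝ, 0 ≤ a → 0 ≤ b → a ≤ b → r * (a + b) ≤ s * b := by
    intro a b ha hb hab
    rcases le_total 0 r with hr | hr <;> nlinarith
  rcases le_total (ω ‖p.1‖) (ω ‖p.2‖) with h | h
  · refine (h7.trans h6).trans (mul_le_mul (le_add_of_nonneg_left (by positivity))
      (Real.exp_le_exp.2 (neg_le_neg (key _ _ w1 w2 h))) (Real.exp_pos _).le (by positivity))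
  · refine h5.trans (mul_le_mul (le_add_of_nonneg_right (by positivity))
      (Real.exp_le_exp.2 (neg_le_neg ?_)) (Real.exp_pos _).le (by positivity))
    rw [WeightFunction.split, add_comm]
    exact key _ _ w2 w1 h

/-! ### Moyal's identity and the reproducing formula -/

theorem integral_gabor_mul_conj_gabor (θ f h : 𝓢(E d, ℂ)) (x : E d) :
    ∫ ξ, gabor θ f (x, ξ) * conj (gabor θ h (x, ξ)) =
      ((2 * Real.pi) ^ d : ℝ) * ∫ y, f y * conj (h y) * (‖θ (y - x)‖ ^ 2 : ℝ) := by
  have h1 := parseval (localize θ x f) (localize θ x h)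
  simp only [fourier_localize, localize_apply] at h1
  rw [h1]
  congr 2
  ext y
  have h2 : θ (y - x) * conj (θ (y - x)) = (‖θ (y - x)‖ ^ 2 : ℝ) := by
    rw [Complex.mul_conj, Complex.normSq_eq_norm_sq]
  rw [map_mul, Complex.conj_conj]
  linear_combination (f y * conj (h y)) * h2

theorem integrable_gabor_mul {f θ : 𝓢(E d, ℂ)} (hf : f ∈ sOmega ω d) (hθ : θ ∈ sOmega ω d)
    {s : ℝ} {C : ℝ} {G : E d × E d → ℂ} (hG : Measurable G)
    (hGb : ∀ p, ‖G p‖ ≤ C * Real.exp (s * ω.split p)) :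
    Integrable fun p => gabor θ f p * G p := by
  obtain ⟨C₁, hC₁, h₁⟩ := exists_norm_gabor_le hf hθ (s + (d + 1))
  refine ((ω.integrable_exp_neg_split (d := d) le_rfl).const_mul (C₁ * C)).mono'
    ((continuous_gabor θ f).measurable.mul hG).aestronglyMeasurable
    (Filter.Eventually.of_forall fun p => ?_)
  rw [norm_mul]
  refine (mul_le_mul (h₁ p) (hGb p) (norm_nonneg _) (by positivity)).trans_eq ?_
  rw [mul_mul_mul_comm, ← Real.exp_add]
  congr 2
  ring

theorem integrable_gabor_mul_conj {f h θ : 𝓢(E d, ℂ)} (hf : f ∈ sOmega ω d)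
    (hh : h ∈ sOmega ω d) (hθ : θ ∈ sOmega ω d) :
    Integrable fun p => gabor θ f p * conj (gabor θ h p) := by
  obtain ⟨C, hC, hb⟩ := exists_norm_gabor_le hh hθ 0
  refine integrable_gabor_mul hf hθ (s := 0) (C := C)
    (Complex.continuous_conj.comp (continuous_gabor θ h)).measurable fun p => ?_
  simpa using hb p

/-- Parseval's identity in ξ for each x, followed by Fubini's theorem: the integral of |θ(y - x)|²
over x does not depend on y. -/
theorem moyal {f h θ : 𝓢(E d, ℂ)} (hf : f ∈ sOmega ω d) (hh : h ∈ sOmega ω d)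
    (hθ : θ ∈ sOmega ω d) :
    ∫ p, gabor θ f p * conj (gabor θ h p) =
      ((2 * Real.pi) ^ d * ∫ y, ‖θ y‖ ^ 2 : ℝ) * ∫ y, f y * conj (h y) := by
  have h1 := integrable_gabor_mul_conj hf hh hθ
  rw [Measure.volume_eq_prod] at h1 ⊢
  rw [integral_prod _ h1]
  simp only [integral_gabor_mul_conj_gabor]
  rw [integral_const_mul]
  have h2 : Integrable (Function.uncurry fun x y : E d =>
      f y * conj (h y) * ((‖θ (y - x)‖ ^ 2 : ℝ) : ℂ)) (volume.prod volume) := by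
    -- Rate `2 * s` for f: one half joins the decay of θ(y - x) to give decay in x, the other half
    -- remains for y.
    set s : ℝ := d + 1 with hs
    have hs0 : 0 ≤ s := by positivity
    obtain ⟨A, hA, hA'⟩ := exists_norm_le hf (2 * s)
    obtain ⟨B, hB, hB'⟩ := exists_norm_le_const h
    obtain ⟨C, hC, hC'⟩ := exists_norm_le hθ s
    obtain ⟨D, hD, hD'⟩ := exists_norm_le_const θ
    refine (((ω.integrable_exp_neg (d := d) le_rfl).mul_prod
      (ω.integrable_exp_neg (d := d) le_rfl)).const_mul (A * B * (C * D))).mono' ?_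
      (Filter.Eventually.of_forall fun z => ?_)
    · have := f.continuous
      have := h.continuous
      have := θ.continuous
      refine Continuous.aestronglyMeasurable ?_
      refine Continuous.mul (Continuous.mul (by fun_prop)
        (Complex.continuous_conj.comp (by fun_prop))) (Complex.continuous_ofReal.comp (by fun_prop))
    · obtain ⟨x, y⟩ := z
      simp only [Function.uncurry_apply_pair, norm_mul, RCLike.norm_conj, Complex.norm_real,
        norm_pow, norm_norm]
      have h3 : Real.exp (-(2 * s * ω ‖y‖)) * Real.exp (-(s * ω ‖y - x‖)) ≤
          Real.exp (-(s * ω ‖x‖)) * Real.exp (-(s * ω ‖y‖)) := by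
        rw [← Real.exp_add, ← Real.exp_add, Real.exp_le_exp]
        have h4 := ω.le_add y x
        rw [norm_sub_rev] at h4
        nlinarith
      calc ‖f y‖ * ‖h y‖ * ‖θ (y - x)‖ ^ 2
          ≤ A * Real.exp (-(2 * s * ω ‖y‖)) * B * (C * Real.exp (-(s * ω ‖y - x‖)) * D) := by
            rw [sq]
            gcongr
            · exact hA' y
            · exact hB' y
            · exact hC' _
            · exact hD' _
        _ = A * B * (C * D) * (Real.exp (-(2 * s * ω ‖y‖)) * Real.exp (-(s * ω ‖y - x‖))) := by
            ring
        _ ≤ _ := by gcongr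
  rw [integral_integral_swap h2]
  have h3 : ∀ y : E d, ∫ x, f y * conj (h y) * ((‖θ (y - x)‖ ^ 2 : ℝ) : ℂ) =
      f y * conj (h y) * ((∫ y, ‖θ y‖ ^ 2 : ℝ) : ℂ) := by
    intro y
    rw [integral_const_mul, integral_complex_ofReal,
      integral_sub_left_eq_self (fun x => ‖θ x‖ ^ 2) volume y]
  simp only [h3]
  rw [integral_mul_const]
  push_cast
  ring

/-- The constant in Moyal's identity. -/
def moyalConst (θ : 𝓢(E d, ℂ)) : ℝ := (2 * Real.pi) ^ d * ∫ y, ‖θ y‖ ^ 2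

theorem moyalConst_pos {θ : 𝓢(E d, ℂ)} (hθ : θ ≠ 0) : 0 < moyalConst θ := by
  refine mul_pos (by positivity) ?_
  obtain ⟨y, hy⟩ : ∃ y, θ y ≠ 0 := by
    by_contra! h
    exact hθ (SchwartzMap.ext h)
  have h1 : Integrable fun y => ‖θ y‖ ^ 2 := by
    have := (integrable_mul_conj θ θ).norm
    simpa [sq] using this
  exact integral_pos_of_integrable_nonneg_nonzero (x := y) (by have := θ.continuous; fun_prop) h1
    (fun _ => by positivity) (by positivity)

theorem shift_mem {θ : 𝓢(E d, ℂ)} (hθ : θ ∈ sOmega ω d) (p : E d × E d) :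
    shift p θ ∈ sOmega ω d :=
  (SOmega.phaseShift (WithLp.toLp 2 p) (SOmega.mk θ hθ)).toSchwartz_mem

/-- Moyal's identity for the pair f, Π(q)φ: exchanging function and window turns the conjugate of
V_θ(Π(q)φ)(p) into V_φ(Π(p)θ)(q). -/
theorem reproducing {f θ φ : 𝓢(E d, ℂ)} (hf : f ∈ sOmega ω d) (hθ : θ ∈ sOmega ω d)
    (hφ : φ ∈ sOmega ω d) (q : E d × E d) :
    ∫ p, gabor θ f p * gabor φ (shift p θ) q = moyalConst θ * gabor φ f q := by
  simp only [← conj_gabor_shift θ φ]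
  exact moyal hf (shift_mem hφ q) hθ

instance : (volume : Measure (E d × E d)).IsAddRightInvariant := by
  rw [Measure.volume_eq_prod]
  infer_instance

/-! ### Seminorms defined by the short-time Fourier transform -/

/-- The weighted `L¹` norm of the short-time Fourier transform. -/
def gaborNorm (ω : WeightFunction) (M : ℝ) (θ f : 𝓢(E d, ℂ)) : ℝ≥0∞ :=
  ∫⁻ p, ENNReal.ofReal (Real.exp (M * ω.split p) * ‖gabor θ f p‖)

theorem measurable_gaborNorm_integrand (ω : WeightFunction) (M : ℝ) (θ f : 𝓢(E d, ℂ)) :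
    Measurable fun p => ENNReal.ofReal (Real.exp (M * ω.split p) * ‖gabor θ f p‖) :=
  (((ω.continuous_exp_split M).mul (continuous_gabor θ f).norm).measurable).ennreal_ofReal

theorem gaborNorm_mono (ω : WeightFunction) {M N : ℝ} (h : M ≤ N) (θ f : 𝓢(E d, ℂ)) :
    gaborNorm ω M θ f ≤ gaborNorm ω N θ f := by
  refine lintegral_mono fun p => ENNReal.ofReal_le_ofReal ?_
  have := ω.split_nonneg p
  gcongr

/-- A change of window in the weighted `L¹` norm. -/
theorem exists_gaborNorm_le {θ φ : 𝓢(E d, ℂ)} (hθ : θ ∈ sOmega ω d) (hθ0 : θ ≠ 0)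
    (hφ : φ ∈ sOmega ω d) {M : ℝ} (hM : 0 ≤ M) :
    ∃ C : NNReal, ∀ f ∈ sOmega ω d, gaborNorm ω M φ f ≤ C * gaborNorm ω M θ f := by
  -- Of this rate, `M` moves the weight from q to p and `d + 1` leaves an integrable kernel in q -
  -- p.
  obtain ⟨K, hK, hKb⟩ := exists_norm_gabor_le hθ hφ (M + (d + 1))
  have hc : 0 < moyalConst θ := moyalConst_pos hθ0
  generalize hcdef : moyalConst θ = c at hc
  set k : E d × E d → ℝ≥0∞ := fun p =>
    ENNReal.ofReal (c⁻¹ * K * Real.exp (-((d + 1) * ω.split p))) with hk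
  have hkm : Measurable k := by
    have h1 := ω.continuous_exp_split (d := d) (-(d + 1))
    simp only [neg_mul] at h1
    exact (continuous_const.mul h1).measurable.ennreal_ofReal
  have hkfin : ∫⁻ p, k p ≠ ⊤ :=
    (((ω.integrable_exp_neg_split (d := d) le_rfl).const_mul (c⁻¹ * K)).lintegral_lt_top).ne
  refine ⟨(∫⁻ p, k p).toNNReal, fun f hf => ?_⟩
  rw [ENNReal.coe_toNNReal hkfin]
  set G : E d × E d → ℝ≥0∞ :=
    fun p => ENNReal.ofReal (Real.exp (M * ω.split p) * ‖gabor θ f p‖) with hG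
  have hGm : Measurable G := measurable_gaborNorm_integrand ω M θ f
  -- By the reproducing formula |V_φ f| is at most a multiple of the convolution of |V_θ f| with
  -- |V_φ θ|. With the weight distributed, what follows is Young's inequality L¹ * L¹ ⊆ L¹, by
  -- Tonelli's theorem.
  have h1 : ∀ q, ENNReal.ofReal (Real.exp (M * ω.split q) * ‖gabor φ f q‖) ≤
      ∫⁻ p, G p * k (q - p) := by
    intro q
    have h2 : gabor φ f q = (c⁻¹ : ℝ) * ∫ p, gabor θ f p * gabor φ (shift p θ) q := by
      rw [reproducing hf hθ hφ, hcdef, ← mul_assoc, ← Complex.ofReal_mul, inv_mul_cancel₀ hc.ne']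
      simp
    rw [h2, norm_mul, Complex.norm_real, Real.norm_of_nonneg (by positivity),
      ENNReal.ofReal_mul (by positivity), ENNReal.ofReal_mul (by positivity), ofReal_norm,
      ← mul_assoc]
    refine (mul_le_mul_right (enorm_integral_le_lintegral_enorm _) _).trans ?_
    have h4 : Continuous fun p : E d × E d => gabor φ (shift p θ) q := by
      have := continuous_gabor φ θ
      simp only [gabor_shift]
      fun_prop
    have h5 : Measurable fun p => ‖gabor θ f p * gabor φ (shift p θ) q‖ₑ :=
      ((continuous_gabor θ f).mul h4).measurable.enorm
    rw [← lintegral_const_mul _ h5]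
    refine lintegral_mono fun p => ?_
    simp only [hG, hk]
    rw [← ofReal_norm, ← ENNReal.ofReal_mul (by positivity), ← ENNReal.ofReal_mul (by positivity),
      ← ENNReal.ofReal_mul (by positivity)]
    refine ENNReal.ofReal_le_ofReal ?_
    rw [norm_mul, norm_gabor_shift]
    have h3 : Real.exp (M * ω.split q) * Real.exp (-((M + (d + 1)) * ω.split (q - p))) ≤
        Real.exp (M * ω.split p) * Real.exp (-((d + 1) * ω.split (q - p))) := by
      rw [← Real.exp_add, ← Real.exp_add, Real.exp_le_exp]
      nlinarith [ω.split_le_add p q]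
    have h5 := hKb (q - p)
    have hc' : 0 ≤ c⁻¹ := (inv_pos.2 hc).le
    generalize ‖gabor φ θ (q - p)‖ = v at h5 ⊢
    have h6 : 0 ≤ ‖gabor θ f p‖ := norm_nonneg _
    generalize ‖gabor θ f p‖ = w at h6 ⊢
    have h7 : 0 ≤ Real.exp (M * ω.split q) := (Real.exp_pos _).le
    calc Real.exp (M * ω.split q) * c⁻¹ * (w * v)
        ≤ Real.exp (M * ω.split q) * c⁻¹ * (w *
          (K * Real.exp (-((M + (d + 1)) * ω.split (q - p))))) :=
          mul_le_mul_of_nonneg_left (mul_le_mul_of_nonneg_left h5 h6) (mul_nonneg h7 hc')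
      _ = c⁻¹ * K * w * (Real.exp (M * ω.split q) *
          Real.exp (-((M + (d + 1)) * ω.split (q - p)))) := by ring
      _ ≤ c⁻¹ * K * w * (Real.exp (M * ω.split p) *
          Real.exp (-((d + 1) * ω.split (q - p)))) :=
          mul_le_mul_of_nonneg_left h3 (mul_nonneg (mul_nonneg hc' hK) h6)
      _ = _ := by ring
  refine (lintegral_mono h1).trans ?_
  rw [lintegral_lintegral_swap]
  · have h4 : ∀ p, ∫⁻ q, G p * k (q - p) = G p * ∫⁻ q, k q := fun p => by
      have h5 : Measurable fun q => k (q - p) := hkm.comp (measurable_id.sub_const p)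
      rw [lintegral_const_mul _ h5, lintegral_sub_right_eq_self]
    simp only [h4]
    rw [lintegral_mul_const _ hGm, mul_comm]
    rfl
  · exact ((hGm.comp measurable_snd).mul
      (hkm.comp (measurable_fst.sub measurable_snd))).aemeasurable

/-- Fourier inversion of a slice bounds |g(y) θ(y - x)| by ∫ |V_θ g(x, ξ)| dξ. After multiplication
by e^{rω(x)} ≥ e^{rω(y)} e^{-rω(y-x)} and integration over x, the left side is e^{rω(y)} |g(y)|
times the integral A of e^{-rω}|θ|, which is finite and, as θ ≠ 0, positive. -/
theorem exists_weightedSup_zero_le (ω : WeightFunction) {θ : 𝓢(E d, ℂ)} (hθ0 : θ ≠ 0) {r : ℝ}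
    (hr : 0 ≤ r) :
    ∃ C : NNReal, ∀ g : 𝓢(E d, ℂ), weightedSup ω r 0 g ≤ C * gaborNorm ω r θ g := by
  set k : E d → ℝ≥0∞ := fun t => ENNReal.ofReal (Real.exp (-(r * ω ‖t‖)) * ‖θ t‖) with hk
  have hkc : Continuous fun t : E d => Real.exp (-(r * ω ‖t‖)) * ‖θ t‖ :=
    (Real.continuous_exp.comp (ω.continuous_apply_norm.const_mul r).neg).mul θ.continuous.norm
  set A := ∫⁻ t, k t with hA
  have hA0 : A ≠ 0 := by
    intro h
    rw [hA, lintegral_eq_zero_iff hkc.measurable.ennreal_ofReal] at h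
    have h1 : (fun t : E d => Real.exp (-(r * ω ‖t‖)) * ‖θ t‖) =ᵐ[volume] fun _ => 0 := by
      filter_upwards [h] with t ht
      have := ENNReal.ofReal_eq_zero.1 ht
      exact le_antisymm this (by positivity)
    rw [Continuous.ae_eq_iff_eq volume hkc continuous_const] at h1
    refine hθ0 (SchwartzMap.ext fun t => ?_)
    have := congrFun h1 t
    simpa [(Real.exp_pos _).ne'] using this
  have hAtop : A ≠ ⊤ := by
    refine ne_top_of_le_ne_top θ.integrable.2.ne (lintegral_mono fun t => ?_)
    rw [hk, ← ofReal_norm]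
    refine ENNReal.ofReal_le_ofReal (mul_le_of_le_one_left (norm_nonneg _) ?_)
    rw [Real.exp_le_one_iff]
    have := ω.apply_norm_nonneg t
    exact neg_nonpos.2 (by positivity)
  refine ⟨A⁻¹.toNNReal, fun g => iSup_le fun y => ?_⟩
  have hkm : Measurable fun x => k (y - x) :=
    hkc.measurable.ennreal_ofReal.comp (measurable_id.const_sub y)
  rw [ENNReal.coe_toNNReal (ENNReal.inv_ne_top.2 hA0), mul_comm A⁻¹, ← div_eq_mul_inv,
    ENNReal.le_div_iff_mul_le (Or.inl hA0) (Or.inl hAtop), hA, multiD_zero,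
    ← lintegral_sub_left_eq_self k y, ← lintegral_const_mul _ hkm]
  rw [gaborNorm, Measure.volume_eq_prod, lintegral_prod _
    (measurable_gaborNorm_integrand ω r θ g).aemeasurable]
  refine lintegral_mono fun x => ?_
  have h1 := enorm_le_lintegral_fourier (localize θ x g) y
  simp only [fourier_localize, localize_apply] at h1
  calc ENNReal.ofReal (Real.exp (r * ω ‖y‖) * ‖g y‖) * k (y - x)
      ≤ ENNReal.ofReal (Real.exp (r * ω ‖x‖)) * ‖conj (θ (y - x)) * g y‖ₑ := by
        rw [hk, ← ofReal_norm, ← ENNReal.ofReal_mul (by positivity),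
          ← ENNReal.ofReal_mul (by positivity)]
        refine ENNReal.ofReal_le_ofReal ?_
        rw [norm_mul, RCLike.norm_conj]
        have h2 : Real.exp (r * ω ‖y‖) * Real.exp (-(r * ω ‖y - x‖)) ≤ Real.exp (r * ω ‖x‖) := by
          rw [← Real.exp_add, Real.exp_le_exp]
          nlinarith [ω.le_add x y]
        calc _ = (Real.exp (r * ω ‖y‖) * Real.exp (-(r * ω ‖y - x‖))) *
              (‖θ (y - x)‖ * ‖g y‖) := by ring
          _ ≤ _ := by gcongr
    _ ≤ ENNReal.ofReal (Real.exp (r * ω ‖x‖)) * ∫⁻ ξ, ‖gabor θ g (x, ξ)‖ₑ := by gcongr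
    _ ≤ _ := by
        have hc : Continuous fun ξ => gabor θ g (x, ξ) := by
          have := continuous_gabor θ g
          fun_prop
        rw [← lintegral_const_mul _ hc.measurable.enorm]
        refine lintegral_mono fun ξ => ?_
        rw [← ofReal_norm, ← ENNReal.ofReal_mul (by positivity)]
        refine ENNReal.ofReal_le_ofReal ?_
        gcongr
        exact le_add_of_nonneg_right (ω.apply_norm_nonneg ξ)

/-! ### Commutation of phase-space shifts with derivatives and coordinates -/

theorem partialD_translation (j : Fin d) (x : E d) (θ : 𝓢(E d, ℂ)) :
    partialD j (translation x θ) = translation x (partialD j θ) := by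
  ext y
  rw [translation_apply, partialD_apply, partialD_apply]
  congr 2
  exact fderiv_comp_sub (f := θ) x

theorem fderiv_character (ξ : E d) (j : Fin d) (y : E d) :
    -Complex.I * fderiv ℝ (character ξ) y (EuclideanSpace.single j (1 : ℝ)) =
      ξ j * character ξ y := by
  have h1 : HasFDerivAt (fun y : E d => (inner ℝ y ξ : ℝ)) (innerSL ℝ ξ) y := by
    have := (innerSL ℝ ξ).hasFDerivAt (x := y)
    refine this.congr_of_eventuallyEq (Filter.Eventually.of_forall fun z => ?_)
    simp [real_inner_comm]
  have h2 : HasFDerivAt (character ξ) (Complex.exp (Complex.I * (inner ℝ y ξ : ℝ)) •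
      (Complex.I • (Complex.ofRealCLM.comp (innerSL ℝ ξ)))) y :=
    ((Complex.ofRealCLM.hasFDerivAt.comp y h1).const_mul Complex.I).cexp
  rw [h2.fderiv]
  simp only [smul_apply, ContinuousLinearMap.comp_apply, innerSL_apply_apply, smul_eq_mul,
    EuclideanSpace.inner_single_right, character, Complex.ofRealCLM_apply]
  simp only [conj_trivial, one_mul]
  linear_combination (-(ξ j : ℂ) * Complex.exp (Complex.I * (inner ℝ y ξ : ℝ))) * Complex.I_mul_I

theorem partialD_shift (j : Fin d) (p : E d × E d) (θ : 𝓢(E d, ℂ)) :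
    partialD j (shift p θ) = (p.2 j : ℂ) • shift p θ + shift p (partialD j θ) := by
  rw [shift, modulation, partialD_smulLeft (character_hasTemperateGrowth _), partialD_translation,
    add_comm]
  congr 1
  simp only [fderiv_character]
  have hg : (fun x => (p.2 j : ℂ) * character p.2 x).HasTemperateGrowth :=
    (Function.HasTemperateGrowth.const _).mul (character_hasTemperateGrowth _)
  ext y
  rw [smul_apply, SchwartzMap.smulLeftCLM_apply_apply (character_hasTemperateGrowth _),
    SchwartzMap.smulLeftCLM_apply_apply hg]
  simp only [smul_eq_mul, mul_assoc]

theorem mulMonomial_shift (j : Fin d) (p : E d × E d) (θ : 𝓢(E d, ℂ)) :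
    mulMonomial (Pi.single j 1) (shift p θ) =
      (p.1 j : ℂ) • shift p θ + shift p (mulMonomial (Pi.single j 1) θ) := by
  ext y
  rw [add_apply, smul_apply, mulMonomial_apply, shift_apply, shift_apply, mulMonomial_apply,
    monomial_single, monomial_single, smul_eq_mul, PiLp.sub_apply]
  push_cast
  ring

/-- Symmetry of D_j, read off on the Fourier side, where D_j is multiplication by the real
coordinate ξ_j. -/
theorem integral_partialD_mul_conj (j : Fin d) (f g : 𝓢(E d, ℂ)) :
    ∫ y, partialD j f y * conj (g y) = ∫ y, f y * conj (partialD j g y) := by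
  have h1 := parseval (partialD j f) g
  have h2 := parseval f (partialD j g)
  have h3 : (((2 * Real.pi) ^ d : ℝ) : ℂ) ≠ 0 := by
    have : (2 * Real.pi) ^ d ≠ 0 := by positivity
    exact_mod_cast this
  refine mul_left_cancel₀ h3 (h1.symm.trans (Eq.trans ?_ h2))
  congr 1
  ext ξ
  rw [fourier_partialD, fourier_partialD, mulMonomial_apply, mulMonomial_apply, monomial_single,
    map_mul, Complex.conj_ofReal]
  ring

/-- D_j is moved to the shifted window and commuted past the shift, so no derivative of f remains:
only a coordinate factor and a new window. -/
theorem gabor_partialD (j : Fin d) (θ f : 𝓢(E d, ℂ)) (p : E d × E d) :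
    gabor θ (partialD j f) p = p.2 j * gabor θ f p + gabor (partialD j θ) f p := by
  rw [gabor, integral_partialD_mul_conj, partialD_shift, gabor, gabor, ← integral_const_mul,
    ← integral_add ((integrable_mul_conj _ _).const_mul _) (integrable_mul_conj _ _)]
  congr 1
  ext y
  simp only [add_apply, smul_apply, smul_eq_mul, map_add, map_mul, Complex.conj_ofReal]
  ring

theorem gabor_mulMonomial_single (j : Fin d) (θ f : 𝓢(E d, ℂ)) (p : E d × E d) :
    gabor θ (mulMonomial (Pi.single j 1) f) p =
      p.1 j * gabor θ f p + gabor (mulMonomial (Pi.single j 1) θ) f p := by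
  rw [gabor, gabor, gabor, ← integral_const_mul,
    ← integral_add ((integrable_mul_conj _ _).const_mul _) (integrable_mul_conj _ _)]
  congr 1
  ext y
  have h := congrArg (fun g : 𝓢(E d, ℂ) => conj (g y)) (mulMonomial_shift j p θ)
  simp only [add_apply, smul_apply, smul_eq_mul, map_add, map_mul, Complex.conj_ofReal,
    mulMonomial_apply, monomial_single] at h ⊢
  linear_combination f y * h

/-! ### The seminorms of `S_ω` in terms of the short-time Fourier transform -/

theorem multiD_mem {f : 𝓢(E d, ℂ)} (hf : f ∈ sOmega ω d) (α : Fin d → ℕ) :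
    multiD α f ∈ sOmega ω d :=
  (SOmega.D α (SOmega.mk f hf)).toSchwartz_mem

theorem partialD_mem {f : 𝓢(E d, ℂ)} (hf : f ∈ sOmega ω d) (j : Fin d) :
    partialD j f ∈ sOmega ω d := by
  rw [← multiD_single]
  exact multiD_mem hf _

theorem mulMonomial_mem {f : 𝓢(E d, ℂ)} (hf : f ∈ sOmega ω d) (α : Fin d → ℕ) :
    mulMonomial α f ∈ sOmega ω d :=
  (SOmega.mulX α (SOmega.mk f hf)).toSchwartz_mem

theorem gaborNorm_le_of_norm_le {θ φ f g : 𝓢(E d, ℂ)} {M C : ℝ} (hC : 0 ≤ C)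
    (h : ∀ p, ‖gabor θ g p‖ ≤ C * Real.exp (ω.split p) * ‖gabor θ f p‖ + ‖gabor φ f p‖) :
    gaborNorm ω M θ g ≤ C.toNNReal * gaborNorm ω (M + 1) θ f + gaborNorm ω M φ f := by
  simp only [gaborNorm]
  rw [← lintegral_const_mul _ (measurable_gaborNorm_integrand ω _ _ _),
    ← lintegral_add_right _ (measurable_gaborNorm_integrand ω _ _ _)]
  refine lintegral_mono fun p => ?_
  change _ ≤ ENNReal.ofReal C * _ + _
  rw [← ENNReal.ofReal_mul hC, ← ENNReal.ofReal_add (by positivity) (by positivity)]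
  refine ENNReal.ofReal_le_ofReal ?_
  refine (mul_le_mul_of_nonneg_left (h p) (Real.exp_pos _).le).trans_eq ?_
  rw [add_mul, Real.exp_add, one_mul]
  ring

theorem exists_coord_le (ω : WeightFunction) (d : ℕ) : ∃ C : ℝ, 0 ≤ C ∧
    ∀ (j : Fin d) (p : E d × E d), ‖(p.1 j : ℂ)‖ ≤ C * Real.exp (ω.split p) ∧
      ‖(p.2 j : ℂ)‖ ≤ C * Real.exp (ω.split p) := by
  obtain ⟨C, hC, h⟩ := ω.exists_norm_le_exp (d := d)
  refine ⟨C, hC, fun j p => ⟨?_, ?_⟩⟩ <;> rw [Complex.norm_real]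
  · refine (PiLp.norm_apply_le p.1 j).trans ((h p.1).trans ?_)
    gcongr
    exact le_add_of_nonneg_right (ω.apply_norm_nonneg _)
  · refine (PiLp.norm_apply_le p.2 j).trans ((h p.2).trans ?_)
    gcongr
    exact le_add_of_nonneg_left (ω.apply_norm_nonneg _)

/-- The common step for D_j and x_j: the coordinate factor costs one unit of weight, and the term
with window φ returns to θ by the change of window. -/
theorem exists_gaborNorm_le_of_eq {θ φ : 𝓢(E d, ℂ)} (hθ : θ ∈ sOmega ω d) (hθ0 : θ ≠ 0)
    (hφ : φ ∈ sOmega ω d) (T : 𝓢(E d, ℂ) → 𝓢(E d, ℂ)) (a : E d × E d → ℂ) {A : ℝ} (hA : 0 ≤ A)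
    (ha : ∀ p, ‖a p‖ ≤ A * Real.exp (ω.split p))
    (hT : ∀ f p, gabor θ (T f) p = a p * gabor θ f p + gabor φ f p) {M : ℝ} (hM : 0 ≤ M) :
    ∃ C : NNReal, ∀ f ∈ sOmega ω d, gaborNorm ω M θ (T f) ≤ C * gaborNorm ω (M + 1) θ f := by
  obtain ⟨C, hC⟩ := exists_gaborNorm_le hθ hθ0 hφ hM
  refine ⟨A.toNNReal + C, fun f hf => ?_⟩
  refine (gaborNorm_le_of_norm_le (f := f) (φ := φ) hA fun p => ?_).trans ?_
  · rw [hT]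
    refine (norm_add_le _ _).trans ?_
    rw [norm_mul]
    gcongr
    exact ha p
  · rw [ENNReal.coe_add, add_mul]
    gcongr
    refine (hC f hf).trans ?_
    gcongr
    exact gaborNorm_mono ω (by linarith) θ f

theorem exists_gaborNorm_multiD_le {θ : 𝓢(E d, ℂ)} (hθ : θ ∈ sOmega ω d) (hθ0 : θ ≠ 0)
    (α : Fin d → ℕ) {M : ℝ} (hM : 0 ≤ M) : ∃ (C : NNReal) (N : ℝ), 0 ≤ N ∧
      ∀ f ∈ sOmega ω d, gaborNorm ω M θ (multiD α f) ≤ C * gaborNorm ω N θ f := by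
  obtain ⟨A, hA, hAb⟩ := exists_coord_le ω d
  refine multiIndex_induction (P := fun α => ∃ (C : NNReal) (N : ℝ), 0 ≤ N ∧
      ∀ f ∈ sOmega ω d, gaborNorm ω M θ (multiD α f) ≤ C * gaborNorm ω N θ f) ?_ ?_ α
  · exact ⟨1, M, hM, fun f _ => by simp [multiD_zero]⟩
  · rintro α j ⟨C, N, hN, h⟩
    obtain ⟨C', h'⟩ := exists_gaborNorm_le_of_eq hθ hθ0 (partialD_mem hθ j) (partialD j)
      (fun p => p.2 j) hA (fun p => (hAb j p).2) (gabor_partialD j θ) hN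
    refine ⟨C * C', N + 1, by positivity, fun f hf => ?_⟩
    rw [multiD_succ, ENNReal.coe_mul, mul_assoc]
    refine (h _ (partialD_mem hf j)).trans ?_
    gcongr
    exact h' f hf

theorem exists_gaborNorm_mulMonomial_le {θ : 𝓢(E d, ℂ)} (hθ : θ ∈ sOmega ω d) (hθ0 : θ ≠ 0)
    (α : Fin d → ℕ) {M : ℝ} (hM : 0 ≤ M) : ∃ (C : NNReal) (N : ℝ), 0 ≤ N ∧
      ∀ f ∈ sOmega ω d, gaborNorm ω M θ (mulMonomial α f) ≤ C * gaborNorm ω N θ f := by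
  obtain ⟨A, hA, hAb⟩ := exists_coord_le ω d
  -- In `mulMonomial_succ` the new coordinate acts last. It is estimated first and raises the
  -- weight, so the induction hypothesis is needed at `M + 1`.
  revert M
  refine multiIndex_induction (P := fun α => ∀ {M : ℝ}, 0 ≤ M → ∃ (C : NNReal) (N : ℝ), 0 ≤ N ∧
      ∀ f ∈ sOmega ω d, gaborNorm ω M θ (mulMonomial α f) ≤ C * gaborNorm ω N θ f) ?_ ?_ α
  · intro M hM
    refine ⟨1, M, hM, fun f _ => ?_⟩
    have : mulMonomial 0 f = f := by
      ext x
      rw [mulMonomial_apply]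
      simp [monomial]
    simp [this]
  · intro α j ih M hM
    obtain ⟨C', h'⟩ := exists_gaborNorm_le_of_eq hθ hθ0 (mulMonomial_mem hθ (Pi.single j 1))
      (mulMonomial (Pi.single j 1)) (fun p => p.1 j) hA (fun p => (hAb j p).1)
      (gabor_mulMonomial_single j θ) hM
    obtain ⟨C, N, hN, h⟩ := ih (M := M + 1) (by positivity)
    refine ⟨C' * C, N, hN, fun f hf => ?_⟩
    rw [mulMonomial_succ, ENNReal.coe_mul, mul_assoc]
    refine (h' _ (mulMonomial_mem hf α)).trans ?_
    gcongr
    exact h f hf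

theorem measurePreserving_rotation :
    MeasurePreserving (fun p : E d × E d => (p.2, -p.1)) := by
  rw [Measure.volume_eq_prod]
  exact ((MeasurePreserving.id volume).prod (Measure.measurePreserving_neg volume)).comp
    Measure.measurePreserving_swap

theorem gaborNorm_fourier (ω : WeightFunction) (M : ℝ) (θ f : 𝓢(E d, ℂ)) :
    gaborNorm ω M (fourier θ) (fourier f) =
      ((2 * Real.pi) ^ d).toNNReal * gaborNorm ω M θ f := by
  rw [gaborNorm, ← measurePreserving_rotation.lintegral_comp
    (measurable_gaborNorm_integrand ω M _ _), gaborNorm,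
    ← lintegral_const_mul _ (measurable_gaborNorm_integrand ω _ _ _)]
  refine lintegral_congr fun p => ?_
  rw [norm_gabor_fourier]
  change _ = ENNReal.ofReal _ * _
  rw [← ENNReal.ofReal_mul (by positivity)]
  congr 1
  have : ω.split (p.2, -p.1) = ω.split p := by
    simp [WeightFunction.split, add_comm]
  rw [this]
  ring

theorem fourier_ne_zero {θ : 𝓢(E d, ℂ)} (hθ0 : θ ≠ 0) : fourier θ ≠ 0 := by
  intro h
  refine hθ0 (SchwartzMap.ext fun y => ?_)
  have := enorm_le_lintegral_fourier θ y
  simpa [h] using this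

theorem exists_weightedSup_le {θ : 𝓢(E d, ℂ)} (hθ : θ ∈ sOmega ω d) (hθ0 : θ ≠ 0) {r : ℝ}
    (hr : 0 < r) (α : Fin d → ℕ) : ∃ (C : NNReal) (N : ℝ), 0 ≤ N ∧
      ∀ f ∈ sOmega ω d, weightedSup ω r α f ≤ C * gaborNorm ω N θ f := by
  obtain ⟨C, h⟩ := exists_weightedSup_zero_le ω hθ0 hr.le
  obtain ⟨C', N, hN, h'⟩ := exists_gaborNorm_multiD_le hθ hθ0 α hr.le
  refine ⟨C * C', N, hN, fun f hf => ?_⟩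
  have h1 := weightedSup_multiD ω r 0 α f
  rw [zero_add] at h1
  rw [← h1, ENNReal.coe_mul, mul_assoc]
  refine (h _).trans ?_
  gcongr
  exact h' f hf

/-- Up to sign, D^α f̂ is the Fourier transform of x^α f, and the weighted L¹ norm is invariant, up
to a constant, when function and window are both Fourier transformed. -/
theorem exists_weightedSup_fourier_le {θ : 𝓢(E d, ℂ)} (hθ : θ ∈ sOmega ω d) (hθ0 : θ ≠ 0) {r : ℝ}
    (hr : 0 < r) (α : Fin d → ℕ) : ∃ (C : NNReal) (N : ℝ), 0 ≤ N ∧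
      ∀ f ∈ sOmega ω d, weightedSup ω r α (fourier f) ≤ C * gaborNorm ω N θ f := by
  obtain ⟨C, h⟩ := exists_weightedSup_zero_le ω (fourier_ne_zero hθ0) hr.le
  obtain ⟨C', N, hN, h'⟩ := exists_gaborNorm_mulMonomial_le hθ hθ0 α hr.le
  refine ⟨C * (((2 * Real.pi) ^ d).toNNReal * C'), N, hN, fun f hf => ?_⟩
  have h1 := weightedSup_multiD ω r 0 α (fourier f)
  have h2 : weightedSup ω r 0 (fourier (mulMonomial α f)) =
      weightedSup ω r 0 (multiD α (fourier f)) := by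
    rw [fourier_mulMonomial, weightedSup_smul]
    simp
  rw [zero_add] at h1
  rw [← h1, ← h2, ENNReal.coe_mul, mul_assoc]
  refine (h _).trans ?_
  rw [gaborNorm_fourier, ENNReal.coe_mul, mul_assoc]
  gcongr
  exact h' f hf

/-! ### Functionals that are bounded by a Hilbert norm -/

/-- The bound lets u descend to a bounded functional on the range of T; Hahn–Banach extends it to H
and Riesz represents it. -/
theorem exists_inner_representation {V H : Type*} [AddCommGroup V] [Module ℂ V]
    [NormedAddCommGroup H] [InnerProductSpace ℂ H] [CompleteSpace H] (T : V →ₗ[ℂ] H)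
    (u : V →ₗ[ℂ] ℂ) {C : ℝ} (h : ∀ f, ‖u f‖ ≤ C * ‖T f‖) : ∃ g : H, ∀ f, u f = inner ℂ g (T f) := by
  obtain ⟨s, hs⟩ := LinearMap.exists_rightInverse_of_surjective T.rangeRestrict
    T.range_rangeRestrict
  have hs' : ∀ y : LinearMap.range T, T (s y) = y := fun y =>
    congrArg Subtype.val (LinearMap.congr_fun hs y)
  have hb : ∀ y, ‖(u ∘ₗ s) y‖ ≤ C * ‖y‖ := fun y => by
    have := h (s y)
    rw [hs'] at this
    exact this
  obtain ⟨l, hl, -⟩ := exists_extension_norm_eq (LinearMap.range T)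
    ((u ∘ₗ s).mkContinuous C hb)
  refine ⟨(InnerProductSpace.toDual ℂ H).symm l, fun f => ?_⟩
  rw [InnerProductSpace.toDual_symm_apply]
  have h1 := hl (T.rangeRestrict f)
  -- T f and T(s(T f)) agree, so the bound forces u to take equal values at f and s(T f). No
  -- continuity of the section s is needed.
  have h2 : u (f - s (T.rangeRestrict f)) = 0 := by
    have h3 := h (f - s (T.rangeRestrict f))
    rw [map_sub T, hs'] at h3
    simpa using h3
  rw [map_sub, sub_eq_zero] at h2
  exact h2.trans h1.symm

/-! ### Continuous functionals on `S_ω` in terms of the short-time Fourier transform -/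

theorem exists_seminorms_le {θ : 𝓢(E d, ℂ)} (hθ : θ ∈ sOmega ω d) (hθ0 : θ ≠ 0)
    (i : (Set.Ioi (0 : ℝ) × (Fin d → ℕ)) ⊕ (Set.Ioi (0 : ℝ) × (Fin d → ℕ))) :
    ∃ (C : NNReal) (N : ℝ), 0 ≤ N ∧ ∀ f : SOmega ω d,
      ENNReal.ofReal (SOmega.seminorms ω d i f) ≤ C * gaborNorm ω N θ f.toSchwartz := by
  rcases i with ⟨r, α⟩ | ⟨r, α⟩
  · obtain ⟨C, N, hN, h⟩ := exists_weightedSup_le hθ hθ0 r.2 α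
    refine ⟨C, N, hN, fun f => le_trans ?_ (h _ f.toSchwartz_mem)⟩
    exact ENNReal.ofReal_toReal_le
  · obtain ⟨C, N, hN, h⟩ := exists_weightedSup_fourier_le hθ hθ0 r.2 α
    refine ⟨C, N, hN, fun f => le_trans ?_ (h _ f.toSchwartz_mem)⟩
    exact ENNReal.ofReal_toReal_le

theorem exists_finset_sup_seminorms_le {θ : 𝓢(E d, ℂ)} (hθ : θ ∈ sOmega ω d) (hθ0 : θ ≠ 0)
    (s : Finset ((Set.Ioi (0 : ℝ) × (Fin d → ℕ)) ⊕ (Set.Ioi (0 : ℝ) × (Fin d → ℕ)))) :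
    ∃ (C : NNReal) (N : ℝ), 0 ≤ N ∧ ∀ f : SOmega ω d,
      ENNReal.ofReal (s.sup (SOmega.seminorms ω d) f) ≤ C * gaborNorm ω N θ f.toSchwartz := by
  classical
  induction s using Finset.induction_on with
  | empty => exact ⟨0, 0, le_rfl, fun f => by simp⟩
  | insert i s _ ih =>
    obtain ⟨C₁, N₁, hN₁, h₁⟩ := ih
    obtain ⟨C₂, N₂, hN₂, h₂⟩ := exists_seminorms_le hθ hθ0 i
    refine ⟨max C₁ C₂, max N₁ N₂, le_max_of_le_left hN₁, fun f => ?_⟩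
    rw [Finset.sup_insert, Seminorm.sup_apply, ENNReal.ofReal_max]
    refine max_le ((h₂ f).trans ?_) ((h₁ f).trans ?_)
    · gcongr
      · exact le_max_right _ _
      · exact gaborNorm_mono ω (le_max_right _ _) _ _
    · gcongr
      · exact le_max_left _ _
      · exact gaborNorm_mono ω (le_max_left _ _) _ _

theorem exists_enorm_apply_le (u : SOmegaDual ω d) {θ : 𝓢(E d, ℂ)} (hθ : θ ∈ sOmega ω d)
    (hθ0 : θ ≠ 0) : ∃ (C : NNReal) (N : ℝ), 0 ≤ N ∧ ∀ f : SOmega ω d,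
      ‖u f‖ₑ ≤ C * gaborNorm ω N θ f.toSchwartz := by
  obtain ⟨s, C, -, h⟩ := Seminorm.bound_of_continuous SOmega.withSeminorms
    ((normSeminorm ℂ ℂ).comp u.toLinearMap) (u.continuous.norm)
  obtain ⟨C', N, hN, h'⟩ := exists_finset_sup_seminorms_le hθ hθ0 s
  refine ⟨C * C', N, hN, fun f => ?_⟩
  have h1 : ‖u f‖ ≤ C * s.sup (SOmega.seminorms ω d) f := h f
  rw [← ofReal_norm]
  refine (ENNReal.ofReal_le_ofReal h1).trans ?_
  rw [ENNReal.ofReal_mul (NNReal.coe_nonneg C), ENNReal.coe_mul, mul_assoc,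
    ENNReal.ofReal_coe_nnreal]
  gcongr
  exact h' f

theorem memLp_exp_neg_split (ω : WeightFunction) (d : ℕ) {s : ℝ} (hs : d + 1 ≤ s) :
    MemLp (fun p : E d × E d => ((Real.exp (-(s * ω.split p)) : ℝ) : ℂ)) 2 := by
  have h1 : Continuous fun p : E d × E d => ((Real.exp (-(s * ω.split p)) : ℝ) : ℂ) := by
    have := ω.continuous_split (d := d)
    fun_prop
  rw [memLp_two_iff_integrable_sq_norm h1.aestronglyMeasurable]
  refine (ω.integrable_exp_neg_split (d := d) (s := 2 * s) (by
    have : (0 : ℝ) ≤ d := Nat.cast_nonneg d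
    linarith)).congr (Filter.Eventually.of_forall fun p => ?_)
  simp only [Complex.norm_real, Real.norm_eq_abs, Real.abs_exp]
  rw [← Real.exp_nat_mul]
  congr 1
  push_cast
  ring

/-- The weighted short-time Fourier transform. -/
def weightedGabor (ω : WeightFunction) (K : ℝ) (θ f : 𝓢(E d, ℂ)) (p : E d × E d) : ℂ :=
  (Real.exp (K * ω.split p) : ℝ) * gabor θ f p

theorem memLp_weightedGabor (K : ℝ) {θ f : 𝓢(E d, ℂ)} (hf : f ∈ sOmega ω d)
    (hθ : θ ∈ sOmega ω d) : MemLp (weightedGabor ω K θ f) 2 := by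
  obtain ⟨C, hC, h⟩ := exists_norm_gabor_le hf hθ (K + (d + 1))
  refine (memLp_exp_neg_split ω d le_rfl).of_le_mul (c := C) ?_
    (Filter.Eventually.of_forall fun p => ?_)
  · exact ((Complex.continuous_ofReal.comp (ω.continuous_exp_split K)).mul
      (continuous_gabor θ f)).aestronglyMeasurable
  · rw [weightedGabor, norm_mul]
    simp only [Complex.norm_real, Real.norm_eq_abs, Real.abs_exp]
    refine (mul_le_mul_of_nonneg_left (h p) (Real.exp_pos _).le).trans_eq ?_
    rw [mul_left_comm, ← Real.exp_add]
    congr 2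
    ring

/-- The weighted short-time Fourier transform as a map into `L²`. -/
def weightedGaborL2 (K : ℝ) {θ : 𝓢(E d, ℂ)} (hθ : θ ∈ sOmega ω d) :
    SOmega ω d →ₗ[ℂ] Lp ℂ 2 (volume : Measure (E d × E d)) where
  toFun f := (memLp_weightedGabor K f.toSchwartz_mem hθ).toLp
  map_add' f g := by
    rw [← MemLp.toLp_add]
    congr 1
    ext p
    simp [weightedGabor, gabor_add, mul_add]
  map_smul' c f := by
    rw [RingHom.id_apply, ← MemLp.toLp_const_smul]
    congr 1
    ext p
    simp [weightedGabor, gabor_smul]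
    ring

/-- Cauchy–Schwarz against e^{-(d+1)ω}: an increase of the weight replaces the L¹ norm by a Hilbert
norm, for which the Riesz theorem is available. -/
theorem exists_gaborNorm_le_norm {θ : 𝓢(E d, ℂ)} (hθ : θ ∈ sOmega ω d) (N : ℝ) :
    ∃ C : NNReal, ∀ f : SOmega ω d, gaborNorm ω N θ f.toSchwartz ≤
      C * ‖weightedGaborL2 (N + (d + 1)) hθ f‖ₑ := by
  have h1 := memLp_exp_neg_split ω d le_rfl
  refine ⟨(eLpNorm (fun p : E d × E d =>
    ((Real.exp (-((d + 1) * ω.split p)) : ℝ) : ℂ)) 2).toNNReal, fun f => ?_⟩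
  rw [ENNReal.coe_toNNReal h1.2.ne]
  have h2 := memLp_weightedGabor (N + (d + 1)) f.toSchwartz_mem hθ
  have h3 : ‖weightedGaborL2 (N + (d + 1)) hθ f‖ₑ =
      eLpNorm (weightedGabor ω (N + (d + 1)) θ f.toSchwartz) 2 := Lp.enorm_toLp h2
  rw [h3]
  refine le_trans (le_of_eq ?_) (eLpNorm_smul_le_mul_eLpNorm (r := 1) h2.1 h1.1)
  rw [eLpNorm_one_eq_lintegral_enorm]
  refine lintegral_congr fun p => ?_
  rw [← ofReal_norm, Pi.smul_apply', norm_smul, weightedGabor, norm_mul]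
  simp only [Complex.norm_real, Real.norm_eq_abs, Real.abs_exp]
  rw [← mul_assoc, ← Real.exp_add]
  congr 3
  ring

/-- Every continuous functional on `S_ω` is given by a function of exponential growth on phase
space. -/
theorem exists_integral_representation (u : SOmegaDual ω d) {θ : 𝓢(E d, ℂ)}
    (hθ : θ ∈ sOmega ω d) (hθ0 : θ ≠ 0) : ∃ (h : E d × E d → ℂ) (K : ℝ), 0 ≤ K ∧ Measurable h ∧
      (Integrable fun p => ‖h p‖ * Real.exp (-(K * ω.split p))) ∧
      ∀ f : SOmega ω d, u f = ∫ p, gabor θ f.toSchwartz p * h p := by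
  obtain ⟨C, N, hN, hu⟩ := exists_enorm_apply_le u hθ hθ0
  obtain ⟨C', hC'⟩ := exists_gaborNorm_le_norm (ω := ω) hθ N
  set K : ℝ := N + (d + 1) with hK
  have hb : ∀ f : SOmega ω d, ‖u.toLinearMap f‖ ≤ (C * C' : NNReal) * ‖weightedGaborL2 K hθ f‖ := by
    intro f
    have h1 : ‖u f‖ₑ ≤ C * (C' * ‖weightedGaborL2 K hθ f‖ₑ) :=
      (hu f).trans (mul_le_mul_right (hC' f) _)
    rw [← ofReal_norm, ← ofReal_norm, ← mul_assoc, ← ENNReal.coe_mul,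
      ← ENNReal.ofReal_coe_nnreal, ← ENNReal.ofReal_mul (NNReal.coe_nonneg _)] at h1
    exact (ENNReal.ofReal_le_ofReal_iff (by positivity)).1 h1
  obtain ⟨g, hg⟩ := exists_inner_representation (weightedGaborL2 K hθ) u.toLinearMap hb
  have hgm : Measurable g := (Lp.stronglyMeasurable g).measurable
  -- The weight in the L² pairing is moved onto g. As g is only in L², the growth of h is controlled
  -- in integrated form: with `d + 1` more in the exponent, the product of two L² functions is
  -- integrable.
  refine ⟨fun p => conj (g p) * (Real.exp (K * ω.split p) : ℝ), K + (d + 1), by positivity,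
    ?_, ?_, fun f => ?_⟩
  · exact (Complex.continuous_conj.measurable.comp hgm).mul
      (Complex.continuous_ofReal.comp (ω.continuous_exp_split K)).measurable
  · refine ((Lp.memLp g).integrable_mul (memLp_exp_neg_split ω d le_rfl)).norm.congr
      (Filter.Eventually.of_forall fun p => ?_)
    simp only [Pi.mul_apply, norm_mul, RCLike.norm_conj, Complex.norm_real, Real.norm_eq_abs,
      Real.abs_exp]
    rw [mul_assoc, ← Real.exp_add]
    congr 2
    ring
  · refine (hg f).trans ?_
    rw [L2.inner_def]
    refine integral_congr_ae ?_
    filter_upwards [(memLp_weightedGabor K f.toSchwartz_mem hθ).coeFn_toLp] with p hp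
    have h1 : weightedGaborL2 K hθ f p = weightedGabor ω K θ f.toSchwartz p := hp
    rw [h1, RCLike.inner_apply, weightedGabor]
    ring

theorem toSchwartz_phaseShift (p : E d × E d) (f : SOmega ω d) :
    (SOmega.phaseShift (WithLp.toLp 2 p) f).toSchwartz = shift p f.toSchwartz := rfl

theorem toSchwartz_ne_zero {f : SOmega ω d} (hf : f ≠ 0) : f.toSchwartz ≠ 0 := by
  intro h
  exact hf (SOmega.toSchwartz_injective (h.trans (map_zero _).symm))

/-- A pointwise bound, although h is controlled only on average: |V_θ(Π(p)θ)(q)| = |V_θ θ(q - p)|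
decays at rate K in q - p, which gives rate K in q at the cost of e^{K(ω(x)+ω(ξ))}, where p = (x,
ξ). -/
theorem exists_norm_apply_phaseShift_le (u : SOmegaDual ω d) {θ : SOmega ω d} (hθ0 : θ ≠ 0) :
    ∃ C K : ℝ, 0 ≤ C ∧ 0 ≤ K ∧ ∀ p : E d × E d,
      ‖u (SOmega.phaseShift (WithLp.toLp 2 p) θ)‖ ≤ C * Real.exp (K * ω.split p) := by
  obtain ⟨h, K, hK, hm, hi, hu⟩ := exists_integral_representation u θ.toSchwartz_mem
    (toSchwartz_ne_zero hθ0)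
  obtain ⟨A, hA, hb⟩ := exists_norm_gabor_le θ.toSchwartz_mem θ.toSchwartz_mem K
  refine ⟨A * ∫ q, ‖h q‖ * Real.exp (-(K * ω.split q)), K, mul_nonneg hA
    (integral_nonneg fun _ => by positivity), hK, fun p => ?_⟩
  rw [hu, mul_right_comm, ← integral_const_mul]
  refine norm_integral_le_of_norm_le (hi.const_mul _) (Filter.Eventually.of_forall fun q => ?_)
  rw [norm_mul, toSchwartz_phaseShift, norm_gabor_shift]
  have h1 : Real.exp (-(K * ω.split (q - p))) ≤
      Real.exp (K * ω.split p) * Real.exp (-(K * ω.split q)) := by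
    rw [← Real.exp_add, Real.exp_le_exp]
    nlinarith [ω.split_le_add p q]
  calc ‖gabor θ.toSchwartz θ.toSchwartz (q - p)‖ * ‖h q‖
      ≤ A * (Real.exp (K * ω.split p) * Real.exp (-(K * ω.split q))) * ‖h q‖ := by
        gcongr
        exact (hb _).trans (by gcongr)
    _ = _ := by ring

/-- The inversion formula for continuous functionals on `S_ω`. -/
theorem moyalConst_mul_apply (u : SOmegaDual ω d) {θ : SOmega ω d} (hθ0 : θ ≠ 0)
    (f : SOmega ω d) : moyalConst θ.toSchwartz * u f =
      ∫ p, gabor θ.toSchwartz f.toSchwartz p * u (SOmega.phaseShift (WithLp.toLp 2 p) θ) := by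
  obtain ⟨h, K, hK, hm, hi, hu⟩ := exists_integral_representation u θ.toSchwartz_mem
    (toSchwartz_ne_zero hθ0)
  obtain ⟨A, hA, hA'⟩ := exists_norm_gabor_le θ.toSchwartz_mem θ.toSchwartz_mem K
  obtain ⟨B, hB, hB'⟩ := exists_norm_gabor_le f.toSchwartz_mem θ.toSchwartz_mem (K + (d + 1))
  simp only [hu, toSchwartz_phaseShift, ← integral_const_mul]
  -- The reproducing formula is inserted inside the representation of u; the claim is then an
  -- exchange of the p and q integrals.
  have h1 : ∀ q, (moyalConst θ.toSchwartz : ℂ) * (gabor θ.toSchwartz f.toSchwartz q * h q) =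
      ∫ p, gabor θ.toSchwartz f.toSchwartz p *
        (gabor θ.toSchwartz (shift p θ.toSchwartz) q * h q) := by
    intro q
    rw [← mul_assoc, ← reproducing f.toSchwartz_mem θ.toSchwartz_mem θ.toSchwartz_mem q,
      ← integral_mul_const]
    simp only [mul_assoc]
  simp only [h1]
  refine integral_integral_swap ?_
  refine ((hi.mul_prod (ω.integrable_exp_neg_split (d := d) le_rfl)).const_mul (A * B)).mono' ?_
    (Filter.Eventually.of_forall fun z => ?_)
  · refine Measurable.aestronglyMeasurable ?_
    have m1 := (continuous_gabor θ.toSchwartz f.toSchwartz).measurable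
    have m2 := (continuous_gabor_shift θ.toSchwartz θ.toSchwartz).measurable
    exact (m1.comp measurable_snd).mul ((m2.comp measurable_swap).mul (hm.comp measurable_fst))
  · obtain ⟨q, p⟩ := z
    simp only [Function.uncurry_apply_pair]
    rw [norm_mul, norm_mul, norm_gabor_shift]
    -- Rate K at p and at q - p yields rate K at q, which absorbs the growth of h; the remaining `d
    -- + 1` makes the p-integral converge.
    have h2 : Real.exp (-((K + (d + 1)) * ω.split p)) * Real.exp (-(K * ω.split (q - p))) ≤
        Real.exp (-(K * ω.split q)) * Real.exp (-((d + 1) * ω.split p)) := by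
      rw [← Real.exp_add, ← Real.exp_add, Real.exp_le_exp]
      nlinarith [ω.split_le_add p q]
    calc ‖gabor θ.toSchwartz f.toSchwartz p‖ *
          (‖gabor θ.toSchwartz θ.toSchwartz (q - p)‖ * ‖h q‖)
        ≤ B * Real.exp (-((K + (d + 1)) * ω.split p)) *
          (A * Real.exp (-(K * ω.split (q - p))) * ‖h q‖) := by
          gcongr
          · exact hB' p
          · exact hA' _
      _ = A * B * ‖h q‖ * (Real.exp (-((K + (d + 1)) * ω.split p)) *
          Real.exp (-(K * ω.split (q - p)))) := by ring
      _ ≤ A * B * ‖h q‖ * (Real.exp (-(K * ω.split q)) *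
          Real.exp (-((d + 1) * ω.split p))) := by gcongr
      _ = _ := by ring

/-! ### Rapid decay on a subset of phase space -/

/-- For every window `θ`, the function `p ↦ u(M_ξ T_x θ)` decays rapidly on `Γ`. -/
def RapidOn (u : SOmegaDual ω d) (Γ : Set (E d × E d)) : Prop :=
  ∀ (θ : SOmega ω d) (r : ℝ), ∃ C : ℝ, 0 ≤ C ∧ ∀ p ∈ Γ,
    ‖u (SOmega.phaseShift (WithLp.toLp 2 p) θ)‖ ≤ C * Real.exp (-(r * ω.split p))

namespace RapidOn

variable {Γ : Set (E d × E d)}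

theorem zero : RapidOn (0 : SOmegaDual ω d) Γ := fun _ _ => ⟨0, le_rfl, fun p _ => by simp⟩

theorem add {u v : SOmegaDual ω d} (hu : RapidOn u Γ) (hv : RapidOn v Γ) :
    RapidOn (u + v) Γ := by
  intro θ r
  obtain ⟨C₁, hC₁, h₁⟩ := hu θ r
  obtain ⟨C₂, hC₂, h₂⟩ := hv θ r
  refine ⟨C₁ + C₂, by positivity, fun p hp => ?_⟩
  rw [add_mul]
  exact (norm_add_le _ _).trans (add_le_add (h₁ p hp) (h₂ p hp))

theorem smul {u : SOmegaDual ω d} (hu : RapidOn u Γ) (c : ℂ) : RapidOn (c • u) Γ := by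
  intro θ r
  obtain ⟨C, hC, h⟩ := hu θ r
  refine ⟨‖c‖ * C, by positivity, fun p hp => ?_⟩
  rw [smul_apply, norm_smul, mul_assoc]
  gcongr
  exact h p hp

theorem sum {ι : Type*} (s : Finset ι) {u : ι → SOmegaDual ω d} (hu : ∀ i, RapidOn (u i) Γ) :
    RapidOn (∑ i ∈ s, u i) Γ :=
  Finset.sum_induction u (fun v => RapidOn v Γ) (fun _ _ => add) zero fun i _ => hu i

/-- The factor a(p) costs one unit of the arbitrary rate r. The other term has window Tθ, which is
why `RapidOn` quantifies over all windows. -/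
theorem comp_of_commute {u : SOmegaDual ω d} (hu : RapidOn u Γ) (T : SOmega ω d →L[ℂ] SOmega ω d)
    (a : E d × E d → ℂ) {A : ℝ} (hA : 0 ≤ A) (ha : ∀ p, ‖a p‖ ≤ A * Real.exp (ω.split p))
    (hT : ∀ p θ, T (SOmega.phaseShift (WithLp.toLp 2 p) θ) =
      a p • SOmega.phaseShift (WithLp.toLp 2 p) θ + SOmega.phaseShift (WithLp.toLp 2 p) (T θ)) :
    RapidOn (u.comp T) Γ := by
  intro θ r
  obtain ⟨C₁, hC₁, h₁⟩ := hu θ (r + 1)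
  obtain ⟨C₂, hC₂, h₂⟩ := hu (T θ) r
  refine ⟨A * C₁ + C₂, by positivity, fun p hp => ?_⟩
  rw [ContinuousLinearMap.comp_apply, hT, map_add, map_smul, add_mul]
  refine (norm_add_le _ _).trans (add_le_add ?_ (h₂ p hp))
  rw [norm_smul]
  refine (mul_le_mul (ha p) (h₁ p hp) (norm_nonneg _) (by positivity)).trans_eq ?_
  rw [mul_mul_mul_comm, ← Real.exp_add]
  congr 2
  ring

theorem comp_mulX {u : SOmegaDual ω d} (hu : RapidOn u Γ) (α : Fin d → ℕ) :
    RapidOn (u.comp (SOmega.mulX α)) Γ := by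
  obtain ⟨A, hA, hAb⟩ := exists_coord_le ω d
  -- The induction replaces u by u ∘ x_j, so u must stay general.
  revert u
  refine multiIndex_induction (P := fun α => ∀ {u : SOmegaDual ω d}, RapidOn u Γ →
    RapidOn (u.comp (SOmega.mulX α)) Γ) ?_ ?_ α
  · intro u hu
    have h : u.comp (SOmega.mulX 0) = u := by
      refine ContinuousLinearMap.ext fun f => congrArg u (SOmega.toSchwartz_injective ?_)
      ext x
      change mulMonomial 0 f.toSchwartz x = _
      rw [mulMonomial_apply]
      simp [monomial]
    rwa [h]
  · intro α j ih u hu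
    have h : u.comp (SOmega.mulX (α + Pi.single j 1)) =
        (u.comp (SOmega.mulX (Pi.single j 1))).comp (SOmega.mulX α) :=
      ContinuousLinearMap.ext fun f => congrArg u (SOmega.toSchwartz_injective
        (mulMonomial_succ α j f.toSchwartz))
    rw [h]
    exact ih (hu.comp_of_commute _ (fun p => p.1 j) hA (fun p => (hAb j p).1) fun p θ =>
      SOmega.toSchwartz_injective (mulMonomial_shift j p θ.toSchwartz))

theorem comp_D {u : SOmegaDual ω d} (hu : RapidOn u Γ) (β : Fin d → ℕ) :
    RapidOn (u.comp (SOmega.D β)) Γ := by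
  obtain ⟨A, hA, hAb⟩ := exists_coord_le ω d
  revert u
  refine multiIndex_induction (P := fun β => ∀ {u : SOmegaDual ω d}, RapidOn u Γ →
    RapidOn (u.comp (SOmega.D β)) Γ) ?_ ?_ β
  · intro u hu
    have h : u.comp (SOmega.D 0) = u := by
      refine ContinuousLinearMap.ext fun f => congrArg u (SOmega.toSchwartz_injective ?_)
      change multiD 0 f.toSchwartz = _
      rw [multiD_zero]
      rfl
    rwa [h]
  · intro β j ih u hu
    have h1 : ∀ f : SOmega ω d,
        (SOmega.D (Pi.single j 1) f).toSchwartz = partialD j f.toSchwartz := fun f => by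
      rw [SOmega.toSchwartz_D, multiD_single]
    have h2 : ∀ f : SOmega ω d,
        SOmega.D (β + Pi.single j 1) f = SOmega.D (Pi.single j 1) (SOmega.D β f) := fun f =>
      SOmega.toSchwartz_injective (by
        rw [h1, SOmega.toSchwartz_D, SOmega.toSchwartz_D, multiD_succ'])
    have h : u.comp (SOmega.D (β + Pi.single j 1)) =
        (u.comp (SOmega.D (Pi.single j 1))).comp (SOmega.D β) :=
      ContinuousLinearMap.ext fun f => congrArg u (h2 f)
    rw [h]
    refine ih (hu.comp_of_commute _ (fun p => p.2 j) hA (fun p => (hAb j p).2) fun p θ =>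
      SOmega.toSchwartz_injective ?_)
    rw [h1, map_add, map_smul, toSchwartz_phaseShift, toSchwartz_phaseShift, h1]
    exact partialD_shift j p θ.toSchwartz

theorem polynomialOperator {u : SOmegaDual ω d} (hu : RapidOn u Γ) (m : ℕ)
    (c : (Fin d → ℕ) → (Fin d → ℕ) → ℂ) :
    RapidOn (SOmegaDual.polynomialOperator m c u) Γ :=
  sum _ fun p => (((hu.comp_D p.2).smul _).comp_mulX p.1).smul _

/-- Rapid decay for one window on `Γ` implies rapid decay for all windows on every subset of `Γ`
that is well separated from the complement of `Γ`. -/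
theorem of_window (u : SOmegaDual ω d) {θ : SOmega ω d} (hθ0 : θ ≠ 0) {Γ' : Set (E d × E d)}
    (h : ∀ r : ℝ, ∃ C : ℝ, 0 ≤ C ∧ ∀ p ∈ Γ,
      ‖u (SOmega.phaseShift (WithLp.toLp 2 p) θ)‖ ≤ C * Real.exp (-(r * ω.split p)))
    {κ : ℝ} (hκ : 0 ≤ κ) (hΓ : ∀ q ∈ Γ', ∀ p ∉ Γ, ω.split q ≤ κ * ω.split (p - q)) :
    RapidOn u Γ' := by
  intro φ r₀
  set r : ℝ := max r₀ 0
  have hr : 0 ≤ r := le_max_right _ _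
  obtain ⟨C₁, hC₁, h₁⟩ := h r
  obtain ⟨C₂, K, hC₂, hK, h₂⟩ := exists_norm_apply_phaseShift_le u hθ0
  -- The rate in p - q is spent as follows. The part r turns decay at p ∈ Γ into decay at q. For p ∉
  -- Γ, the part rκ dominates r times the weight of q by separation, and K(1 + κ) dominates K times
  -- the weight of p, itself at most 1 + κ times that of p - q. The part `d + 1` is for integration
  -- over p.
  obtain ⟨A, hA, h₃⟩ := exists_norm_gabor_le φ.toSchwartz_mem θ.toSchwartz_mem
    (r + K * (1 + κ) + r * κ + (d + 1))
  have hc : 0 < moyalConst θ.toSchwartz := moyalConst_pos (toSchwartz_ne_zero hθ0)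
  set J := ∫ p : E d × E d, Real.exp (-((d + 1) * ω.split p)) with hJdef
  have hJ : 0 ≤ J := integral_nonneg fun _ => (Real.exp_pos _).le
  refine ⟨(moyalConst θ.toSchwartz)⁻¹ * (A * (C₁ + C₂) * J), by positivity, fun q hq => ?_⟩
  have h4 : moyalConst θ.toSchwartz * ‖u (SOmega.phaseShift (WithLp.toLp 2 q) φ)‖ ≤
      A * (C₁ + C₂) * Real.exp (-(r * ω.split q)) * J := by
    have h5 := congrArg norm
      (moyalConst_mul_apply u hθ0 (SOmega.phaseShift (WithLp.toLp 2 q) φ))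
    rw [norm_mul, Complex.norm_real, Real.norm_of_nonneg hc.le] at h5
    have h6 : ∫ p : E d × E d, Real.exp (-((d + 1) * ω.split (p - q))) = J :=
      integral_sub_right_eq_self (fun p => Real.exp (-((d + 1) * ω.split p))) q
    rw [h5, ← h6, ← integral_const_mul]
    refine norm_integral_le_of_norm_le
      (((ω.integrable_exp_neg_split (d := d) le_rfl).comp_sub_right q).const_mul _)
      (Filter.Eventually.of_forall fun p => ?_)
    rw [norm_mul, toSchwartz_phaseShift, norm_gabor_shift]
    have hs := ω.split_nonneg (p - q)
    have hq0 := ω.split_nonneg q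
    have hsum : ω.split q ≤ ω.split (p - q) + ω.split p := by
      rw [ω.split_sub_comm]
      exact ω.split_le_add p q
    have hsum' := ω.split_le_add q p
    have hKκ : 0 ≤ K * (1 + κ) := by positivity
    have hrκ : 0 ≤ r * κ := by positivity
    by_cases hp : p ∈ Γ
    · refine (mul_le_mul (h₃ _) (h₁ p hp) (norm_nonneg _) (by positivity)).trans ?_
      rw [mul_mul_mul_comm, mul_assoc (A * (C₁ + C₂)), ← Real.exp_add, ← Real.exp_add]
      refine mul_le_mul (by nlinarith) (Real.exp_le_exp.2 ?_) (Real.exp_pos _).le (by positivity)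
      nlinarith [mul_le_mul_of_nonneg_left hsum hr, mul_nonneg hKκ hs, mul_nonneg hrκ hs]
    · refine (mul_le_mul (h₃ _) (h₂ p) (norm_nonneg _) (by positivity)).trans ?_
      rw [mul_mul_mul_comm, mul_assoc (A * (C₁ + C₂)), ← Real.exp_add, ← Real.exp_add]
      refine mul_le_mul (by nlinarith) (Real.exp_le_exp.2 ?_) (Real.exp_pos _).le (by positivity)
      have h7 := hΓ q hq p hp
      nlinarith [mul_le_mul_of_nonneg_left h7 hr, mul_le_mul_of_nonneg_left h7 hK,
        mul_le_mul_of_nonneg_left hsum' hK, mul_nonneg hr hs]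
  have h7 : ‖u (SOmega.phaseShift (WithLp.toLp 2 q) φ)‖ ≤
      (moyalConst θ.toSchwartz)⁻¹ * (A * (C₁ + C₂) * Real.exp (-(r * ω.split q)) * J) := by
    rwa [inv_mul_eq_div, le_div_iff₀ hc, mul_comm]
  have h8 : Real.exp (-(r * ω.split q)) ≤ Real.exp (-(r₀ * ω.split q)) := by
    have := ω.split_nonneg q
    gcongr
    exact le_max_left _ _
  refine h7.trans ?_
  calc _ = (moyalConst θ.toSchwartz)⁻¹ * (A * (C₁ + C₂) * J) * Real.exp (-(r * ω.split q)) := by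
        ring
    _ ≤ _ := by gcongr

end RapidOn

/-! ### Cones in phase space -/

theorem WeightFunction.apply_le_split (ω : WeightFunction) (z : PhaseSpace d) :
    ω ‖z‖ ≤ ω.split z.ofLp := by
  have h : ‖z‖ ≤ ‖z.fst‖ + ‖z.snd‖ := by
    have h1 := WithLp.prod_norm_sq_eq_of_L2 z
    refine le_of_sq_le_sq ?_ (by positivity)
    nlinarith [mul_nonneg (norm_nonneg z.fst) (norm_nonneg z.snd)]
  exact (ω.monotoneOn (norm_nonneg z) (Set.mem_Ici.2 (by positivity)) h).trans
    (ω.subadditive _ _ (norm_nonneg _) (norm_nonneg _))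

theorem WeightFunction.split_le_two_mul (ω : WeightFunction) (z : PhaseSpace d) :
    ω.split z.ofLp ≤ 2 * ω ‖z‖ := by
  have h1 : ω ‖z.fst‖ ≤ ω ‖z‖ :=
    ω.monotoneOn (norm_nonneg _) (norm_nonneg z) (WithLp.norm_fst_le _ z)
  have h2 : ω ‖z.snd‖ ≤ ω ‖z‖ :=
    ω.monotoneOn (norm_nonneg _) (norm_nonneg z) (WithLp.norm_snd_le _ z)
  change ω ‖z.fst‖ + ω ‖z.snd‖ ≤ _
  linarith

/-- Subadditivity takes the place of homogeneity when norms are compared up to a constant. The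
multiplier is `n + 1` because ω(0) ≤ 0 may fail. -/
theorem WeightFunction.apply_nat_mul_le (ω : WeightFunction) (n : ℕ) {t : ℝ} (ht : 0 ≤ t) :
    ω ((n + 1 : ℕ) * t) ≤ (n + 1 : ℕ) * ω t := by
  induction n with
  | zero => simp
  | succ n ih =>
    have h := ω.subadditive ((n + 1 : ℕ) * t) t (by positivity) ht
    have h1 : ((n + 1 + 1 : ℕ) : ℝ) * t = (n + 1 : ℕ) * t + t := by push_cast; ring
    have h2 : ((n + 1 + 1 : ℕ) : ℝ) * ω t = (n + 1 : ℕ) * ω t + ω t := by push_cast; ring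
    rw [h1, h2]
    linarith

/-- An open cone contains a smaller open cone around each of its points that is well separated
from the complement. -/
theorem exists_subcone (ω : WeightFunction) {Γ : Set (PhaseSpace d)} (hΓ : IsOpen Γ)
    (hΓ0 : (0 : PhaseSpace d) ∉ Γ) (hcone : ∀ z ∈ Γ, ∀ t : ℝ, 0 < t → t • z ∈ Γ)
    {z₀ : PhaseSpace d} (hz₀ : z₀ ∈ Γ) :
    ∃ Γ' : Set (PhaseSpace d), IsOpen Γ' ∧ (0 : PhaseSpace d) ∉ Γ' ∧
      (∀ z ∈ Γ', ∀ t : ℝ, 0 < t → t • z ∈ Γ') ∧ z₀ ∈ Γ' ∧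
      ∃ κ : ℝ, 0 ≤ κ ∧ ∀ w ∈ Γ', ∀ z ∉ Γ, ω.split w.ofLp ≤ κ * ω.split (z - w).ofLp := by
  obtain ⟨ε, hε, hball⟩ := Metric.isOpen_iff.1 hΓ z₀ hz₀
  have hz₀ε : ε ≤ ‖z₀‖ := by
    by_contra! h
    exact hΓ0 (hball (by simpa using h))
  -- The cone over the ball of radius ε/2 about z₀. It misses 0 because ε ≤ |z₀|.
  refine ⟨{w | ∃ t : ℝ, 0 < t ∧ ‖t • w - z₀‖ < ε / 2}, ?_, ?_, ?_, ?_, ?_⟩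
  · have : {w : PhaseSpace d | ∃ t : ℝ, 0 < t ∧ ‖t • w - z₀‖ < ε / 2} =
        ⋃ t ∈ Set.Ioi (0 : ℝ), {w | ‖t • w - z₀‖ < ε / 2} := by
      ext w
      simp
    rw [this]
    exact isOpen_biUnion fun t _ => isOpen_lt (by fun_prop) continuous_const
  · rintro ⟨t, -, ht⟩
    rw [smul_zero, zero_sub, norm_neg] at ht
    linarith
  · rintro z ⟨t, ht, h⟩ s hs
    refine ⟨t / s, by positivity, ?_⟩
    rwa [smul_smul, div_mul_cancel₀ _ hs.ne']
  · exact ⟨1, one_pos, by simpa using by positivity⟩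
  · obtain ⟨n, hn⟩ := exists_nat_ge (3 * ‖z₀‖ / ε)
    refine ⟨2 * (n + 1 : ℕ), by positivity, ?_⟩
    rintro w ⟨t, ht, hw⟩ z hz
    have h1 : ε ≤ ‖t • z - z₀‖ := by
      by_contra! h
      have h2 : t • z ∈ Γ := hball (by rwa [Metric.mem_ball, dist_eq_norm])
      have h3 := hcone _ h2 t⁻¹ (inv_pos.2 ht)
      rw [smul_smul, inv_mul_cancel₀ ht.ne', one_smul] at h3
      exact hz h3
    have h2 : ε / 2 ≤ ‖t • (z - w)‖ := by
      have : t • z - z₀ = t • (z - w) + (t • w - z₀) := by rw [smul_sub]; abel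
      rw [this] at h1
      linarith [norm_add_le (t • (z - w)) (t • w - z₀)]
    have h3 : ‖t • w‖ ≤ 3 * ‖z₀‖ / 2 := by
      have : t • w = (t • w - z₀) + z₀ := by abel
      rw [this]
      linarith [norm_add_le (t • w - z₀) z₀]
    have h4 : ‖w‖ ≤ (n + 1 : ℕ) * ‖z - w‖ := by
      rw [norm_smul, Real.norm_of_nonneg ht.le] at h2 h3
      rw [div_le_iff₀ hε] at hn
      have h5 : t * ‖w‖ ≤ t * (n * ‖z - w‖) := by
        calc t * ‖w‖ ≤ 3 * ‖z₀‖ / 2 := h3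
          _ ≤ n * (ε / 2) := by linarith
          _ ≤ n * (t * ‖z - w‖) := by gcongr
          _ = _ := by ring
      have h6 := le_of_mul_le_mul_left h5 ht
      push_cast
      linarith [norm_nonneg (z - w)]
    calc ω.split w.ofLp ≤ 2 * ω ‖w‖ := ω.split_le_two_mul w
      _ ≤ 2 * ω ((n + 1 : ℕ) * ‖z - w‖) := by
          gcongr
          exact ω.monotoneOn (norm_nonneg w) (Set.mem_Ici.2 (by positivity)) h4
      _ ≤ 2 * ((n + 1 : ℕ) * ω ‖z - w‖) := by
          gcongr
          exact ω.apply_nat_mul_le n (norm_nonneg _)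
      _ ≤ 2 * ((n + 1 : ℕ) * ω.split (z - w).ofLp) := by
          gcongr
          exact ω.apply_le_split _
      _ = _ := by ring

/-! ### The short-time Fourier transform of functionals -/

/-- The reflection `(x, ξ) ↦ (x, -ξ)` of phase space. -/
def reflect (p : E d × E d) : E d × E d := (p.1, -p.2)

theorem reflect_reflect (p : E d × E d) : reflect (reflect p) = p := by simp [reflect]

theorem reflect_sub (p q : E d × E d) : reflect (p - q) = reflect p - reflect q := by
  simp only [reflect, Prod.fst_sub, Prod.snd_sub, neg_sub', Prod.mk_sub_mk]

theorem WeightFunction.split_reflect (ω : WeightFunction) (p : E d × E d) :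
    ω.split (reflect p) = ω.split p := by
  simp [split, reflect]

/-- The pairing conjugates its test function, and the conjugate of Π(x, ξ)φ is Π(x, -ξ) applied to
the conjugate of φ. -/
theorem stft_eq (φ : SOmega ω d) (u : SOmegaDual ω d) (z : PhaseSpace d) :
    SOmegaDual.stft φ u z =
      u (SOmega.phaseShift (WithLp.toLp 2 (reflect z.ofLp)) φ.conjugate) := by
  refine congrArg u (SOmega.toSchwartz_injective (SchwartzMap.ext fun y => ?_))
  rw [SOmega.phaseShift_apply]
  change conj ((SOmega.phaseShift z φ).toSchwartz y) =
    Complex.exp (Complex.I * (inner ℝ y (-z.snd) : ℝ)) * conj (φ.toSchwartz (y - z.fst))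
  rw [SOmega.phaseShift_apply, map_mul, ← Complex.exp_conj, inner_neg_right]
  simp

theorem conjugate_ne_zero {φ : SOmega ω d} (hφ : φ ≠ 0) : φ.conjugate ≠ 0 := by
  intro h
  refine hφ (SOmega.toSchwartz_injective (SchwartzMap.ext fun y => ?_))
  have h1 : conj (φ.toSchwartz y) = 0 := congrArg (fun f : SOmega ω d => f.toSchwartz y) h
  exact (map_eq_zero _).1 h1

end OmegaGabor

end

/-! ### The inclusion of wave front sets -/

theorem mainTheorem7 (d : ℕ) (ω : OmegaGabor.WeightFunction) (m : ℕ)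
    (c : (Fin d → ℕ) → (Fin d → ℕ) → ℂ) (u : OmegaGabor.SOmegaDual ω d)
    (φ ψ : OmegaGabor.SOmega ω d) (hφ : φ ≠ 0) (hψ : ψ ≠ 0) :
    OmegaGabor.SOmegaDual.waveFrontSet φ (OmegaGabor.SOmegaDual.polynomialOperator m c u) ⊆
      OmegaGabor.SOmegaDual.waveFrontSet ψ u := by
  rintro z₀ ⟨hz₀, h⟩
  refine ⟨hz₀, fun ⟨Γ, hΓ, hΓ0, hcone, hz₀Γ, hdecay⟩ => h ?_⟩
  obtain ⟨Γ', hΓ', hΓ0', hcone', hz₀Γ', κ, hκ, hsep⟩ :=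
    OmegaGabor.exists_subcone ω hΓ hΓ0 hcone hz₀Γ
  -- The cones are pulled back by the reflection ξ ↦ -ξ, which preserves the weight and differences,
  -- hence also the separation of the cones.
  have hrapid : OmegaGabor.RapidOn u {p | WithLp.toLp 2 (OmegaGabor.reflect p) ∈ Γ'} := by
    refine OmegaGabor.RapidOn.of_window u (OmegaGabor.conjugate_ne_zero hψ)
      (Γ := {p | WithLp.toLp 2 (OmegaGabor.reflect p) ∈ Γ}) (fun r => ?_) hκ fun q hq p hp => ?_
    -- Rate 2r in ω(z) gives rate r in ω(x) + ω(ξ) ≤ 2ω(z); the maximum with 1 keeps the rate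
    -- positive, as `hdecay` requires.
    · obtain ⟨C, hC⟩ := hdecay (max (2 * r) 1) (by positivity)
      refine ⟨max C 0, le_max_right _ _, fun p hp => ?_⟩
      have h1 := hC (Set.mem_image_of_mem _ hp)
      simp only [OmegaGabor.stft_eq, OmegaGabor.reflect_reflect] at h1
      have h2 := ω.apply_le_split (WithLp.toLp 2 (OmegaGabor.reflect p))
      have h3 := ω.split_le_two_mul (WithLp.toLp 2 (OmegaGabor.reflect p))
      simp only [ω.split_reflect] at h2 h3
      rw [Real.exp_neg, ← div_eq_mul_inv, le_div_iff₀ (Real.exp_pos _), mul_comm]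
      refine (mul_le_mul_of_nonneg_right (Real.exp_le_exp.2 ?_) (norm_nonneg _)).trans
        (h1.trans (le_max_left _ _))
      have h4 := ω.nonneg _ (norm_nonneg (WithLp.toLp 2 (OmegaGabor.reflect p)))
      have h5 := ω.split_nonneg p
      rcases le_total 0 r with hr | hr
      · nlinarith [le_max_left (2 * r) 1]
      · nlinarith [le_max_right (2 * r) 1]
    · have h1 := hsep _ hq _ hp
      rw [← WithLp.toLp_sub, ← OmegaGabor.reflect_sub] at h1
      simpa only [ω.split_reflect] using h1
  refine ⟨Γ', hΓ', hΓ0', hcone', hz₀Γ', fun r hr => ?_⟩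
  -- Decay of u on the smaller cone holds for every window, so it passes to A(x,D)u and can be read
  -- off with the conjugate of φ.
  obtain ⟨C, hC, hb⟩ := (hrapid.polynomialOperator m c) φ.conjugate r
  refine ⟨C, ?_⟩
  rintro _ ⟨z, hz, rfl⟩
  have h1 := hb (OmegaGabor.reflect z.ofLp) (by
    rw [Set.mem_ofPred_eq, OmegaGabor.reflect_reflect]
    exact hz)
  rw [ω.split_reflect, Real.exp_neg, ← div_eq_mul_inv, le_div_iff₀ (Real.exp_pos _)] at h1
  simp only [OmegaGabor.stft_eq]
  refine le_trans ?_ h1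
  rw [mul_comm]
  gcongr
  exact ω.apply_le_split z
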